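/- Let $\gamma,\mu,\lambda>0$, let $\omega^*=\frac{4}{\gamma^2}\frac{\mu+1}{\mu}$, and let $\omega>\omega^*$. Let $H_\gamma$ be the operator in $L^2(\mathbb R;\mathbb C)$ acting as $H_\gamma u=-u''$ away from the origin on the domain $$D(H_\gamma)=\{u\in H^2(\mathbb R\setminus\{0\}) : u'(0+)=u'(0-),\ u(0+)-u(0-)=-\gamma\,u'(0+)\}.$$ Then the system $$t_1^{2\mu}-t_1^{2\mu+2}=t_2^{2\mu}-t_2^{2\mu+2},\qquad t_1^{-1}+t_2^{-1}=\gamma\sqrt\omega$$ has exactly one solution $(t_1,t_2)$ with $0<t_1<t_2$ (and then $t_2<1$). Put $y_j=\frac{1}{2\mu\sqrt\omega}\log\left|\frac{1+t_j}{1-t_j}\right|$ (so that $\tanh(\mu\sqrt\omega\,y_j)=t_j$), and for $\theta\in\mathbb R$ let $$\psi(x)=\psi_\omega^{y_1,-y_2,\theta}(x)=\begin{cases}-e^{i\theta}\phi(x-y_1),&x<0,\\ e^{i\theta}\phi(x+y_2),&x>0,\end{cases}\qquad \phi(x)=\lambda^{-\frac1{2\mu}}(\mu+1)^{\frac1{2\mu}}\omega^{\frac1{2\mu}}\operatorname{sech}^{\frac1\mu}(\mu\sqrt\omega\,x).$$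 Consider the operator $$L_1u=H_\gamma u+\omega u-(2\mu+1)\lambda|\psi|^{2\mu}u,\qquad D(L_1)=D(H_\gamma),$$ in $L^2(\mathbb R;\mathbb C)$; equivalently, the potential term is $-\frac{\omega(\mu+1)(2\mu+1)}{\cosh^2(\mu\sqrt\omega(x-y_1))}$ for $x<0$ and $-\frac{\omega(\mu+1)(2\mu+1)}{\cosh^2(\mu\sqrt\omega(x+y_2))}$ for $x>0$. Then $L_1$ has trivial kernel, and it has exactly one negative eigenvalue, which is simple (its eigenspace has dimension one). -/

import Mathlib

open MeasureTheory Filter Topology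
open scoped ENNReal

noncomputable section

/-- The Hilbert space `L²(ℝ; ℂ)`. -/
abbrev L2 : Type := Lp ℂ 2 (volume : Measure ℝ)

/-! ### Sobolev functions on `ℝ ∖ {0}` -/

/-- `g` is the weak derivative of `f` on `ℝ ∖ {0}`: integration by parts holds against every smooth
test function whose support is a compact subset of `ℝ ∖ {0}`. -/
def IsWeakDeriv (f g : L2) : Prop :=
  ∀ φ : ℝ → ℝ, ContDiff ℝ ((⊤ : ℕ∞) : WithTop ℕ∞) φ → HasCompactSupport φ → tsupport φ ⊆ {0}ᶜ →
    ∫ x, deriv φ x • f x = -∫ x, φ x • g x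

/-- `a` is the one-sided limit `f (0+)` of the class `f`: the limit at `0` from the right, null sets
being disregarded (for a class with a representative that is continuous on `(0, ∞)`
this is the limit of that representative). -/
def HasRightTrace (f : L2) (a : ℂ) : Prop :=
  Tendsto f (𝓝[>] 0 ⊓ ae volume) (𝓝 a)

/-- `a` is the one-sided limit `f (0-)` of the class `f`, null sets being disregarded. -/
def HasLeftTrace (f : L2) (a : ℂ) : Prop :=
  Tendsto f (𝓝[<] 0 ⊓ ae volume) (𝓝 a)

/-- `u ∈ H²(ℝ ∖ {0})` with weak derivatives `u'` and `u''` in `L²`. -/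
structure IsH2With (u u' u'' : L2) : Prop where
  first : IsWeakDeriv u u'
  second : IsWeakDeriv u' u''

/-- The boundary conditions of the `δ'` interaction of strength `γ` at the origin:
`u'(0+) = u'(0-)` and `u(0+) - u(0-) = -γ u'(0+)`. -/
def DeltaPrimeCondition (γ : ℝ) (u u' : L2) : Prop :=
  ∃ a b d : ℂ, HasRightTrace u a ∧ HasLeftTrace u b ∧ HasRightTrace u' d ∧ HasLeftTrace u' d ∧
    a - b = -(γ : ℂ) * d

/-! ### Facts needed for the operator to be well defined -/

theorem integrable_test_smul (f : L2) {φ : ℝ → ℝ} (hφ : Continuous φ) (hc : HasCompactSupport φ) :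
    Integrable (fun x => φ x • f x) :=
  ((Lp.memLp f).locallyIntegrable (by norm_num)).integrable_smul_left_of_hasCompactSupport hφ hc

theorem IsWeakDeriv.add {f g f₁ g₁ : L2} (h : IsWeakDeriv f g) (h₁ : IsWeakDeriv f₁ g₁) :
    IsWeakDeriv (f + f₁) (g + g₁) := by
  intro φ hφ hc hs
  have hd : Continuous (deriv φ) := hφ.continuous_deriv (by simp)
  have e1 : ∫ x, deriv φ x • (f + f₁ : L2) x
      = ∫ x, (deriv φ x • f x + deriv φ x • f₁ x) := by
    refine integral_congr_ae ?_
    filter_upwards [Lp.coeFn_add f f₁] with x hx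
    rw [hx, Pi.add_apply, smul_add]
  have e2 : ∫ x, φ x • (g + g₁ : L2) x = ∫ x, (φ x • g x + φ x • g₁ x) := by
    refine integral_congr_ae ?_
    filter_upwards [Lp.coeFn_add g g₁] with x hx
    rw [hx, Pi.add_apply, smul_add]
  rw [e1, e2, integral_add (integrable_test_smul f hd hc.deriv)
    (integrable_test_smul f₁ hd hc.deriv), integral_add (integrable_test_smul g hφ.continuous hc)
    (integrable_test_smul g₁ hφ.continuous hc), h φ hφ hc hs, h₁ φ hφ hc hs]
  ring

theorem IsWeakDeriv.const_smul {f g : L2} (h : IsWeakDeriv f g) (c : ℂ) :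
    IsWeakDeriv (c • f) (c • g) := by
  intro φ hφ hc hs
  have e1 : ∫ x, deriv φ x • (c • f : L2) x = ∫ x, c • (deriv φ x • f x) := by
    refine integral_congr_ae ?_
    filter_upwards [Lp.coeFn_smul c f] with x hx
    simp [hx, mul_left_comm]
  have e2 : ∫ x, φ x • (c • g : L2) x = ∫ x, c • (φ x • g x) := by
    refine integral_congr_ae ?_
    filter_upwards [Lp.coeFn_smul c g] with x hx
    simp [hx, mul_left_comm]
  rw [e1, e2, integral_smul, integral_smul, h φ hφ hc hs, smul_neg]

theorem isWeakDeriv_zero : IsWeakDeriv 0 0 := by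
  intro φ hφ hc hs
  have e : ∀ χ : ℝ → ℝ, ∫ x, χ x • (0 : L2) x = 0 := fun χ => by
    refine integral_eq_zero_of_ae ?_
    filter_upwards [Lp.coeFn_zero ℂ 2 (volume : Measure ℝ)] with x hx
    rw [hx, Pi.zero_apply, smul_zero]
  rw [e, e, neg_zero]

/-- Weak derivatives are unique. -/
theorem IsWeakDeriv.unique {f g g₁ : L2} (h : IsWeakDeriv f g) (h₁ : IsWeakDeriv f g₁) :
    g = g₁ := by
  have hl : LocallyIntegrable (fun x => g x - g₁ x) :=
    ((Lp.memLp g).locallyIntegrable (by norm_num)).sub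
      ((Lp.memLp g₁).locallyIntegrable (by norm_num))
  have key := (isOpen_compl_singleton (x := (0 : ℝ))).ae_eq_zero_of_integral_contDiff_smul_eq_zero
    (hl.locallyIntegrableOn {0}ᶜ) (fun φ hφ hc hs => by
      have e := (h φ hφ hc hs).symm.trans (h₁ φ hφ hc hs)
      simp only [smul_sub]
      rw [integral_sub (integrable_test_smul g hφ.continuous hc)
        (integrable_test_smul g₁ hφ.continuous hc), neg_injective e, sub_self])
  refine Lp.ext ?_
  have h0 : ∀ᵐ x : ℝ, x ∈ ({0}ᶜ : Set ℝ) := by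
    rw [ae_iff]; simp
  filter_upwards [key, h0] with x hx hx0
  exact sub_eq_zero.1 (hx hx0)

theorem tendsto_add_class {l : Filter ℝ} {f g : L2} {a b : ℂ}
    (hf : Tendsto f (l ⊓ ae volume) (𝓝 a)) (hg : Tendsto g (l ⊓ ae volume) (𝓝 b)) :
    Tendsto (f + g : L2) (l ⊓ ae volume) (𝓝 (a + b)) :=
  (hf.add hg).congr' (((Lp.coeFn_add f g).filter_mono inf_le_right).mono fun _ hx => hx.symm)

theorem tendsto_smul_class {l : Filter ℝ} {f : L2} {a : ℂ} (c : ℂ)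
    (hf : Tendsto f (l ⊓ ae volume) (𝓝 a)) :
    Tendsto (c • f : L2) (l ⊓ ae volume) (𝓝 (c • a)) :=
  (hf.const_smul c).congr' (((Lp.coeFn_smul c f).filter_mono inf_le_right).mono fun _ hx => hx.symm)

theorem tendsto_zero_class (l : Filter ℝ) : Tendsto (0 : L2) (l ⊓ ae volume) (𝓝 0) :=
  tendsto_const_nhds.congr'
    (((Lp.coeFn_zero ℂ 2 (volume : Measure ℝ)).filter_mono inf_le_right).mono fun _ hx => hx.symm)

/-! ### The Hamiltonian of the `δ'` interaction -/

/-- The domain of `H_γ`: the functions `u ∈ H²(ℝ ∖ {0})` with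
`u'(0+) = u'(0-)` and `u(0+) - u(0-) = -γ u'(0+)`. -/
def deltaPrimeDomain (γ : ℝ) : Submodule ℂ L2 where
  carrier := {u | ∃ u' u'' : L2, IsH2With u u' u'' ∧ DeltaPrimeCondition γ u u'}
  zero_mem' := ⟨0, 0, ⟨isWeakDeriv_zero, isWeakDeriv_zero⟩, 0, 0, 0, tendsto_zero_class _,
    tendsto_zero_class _, tendsto_zero_class _, tendsto_zero_class _, by simp⟩
  add_mem' := by
    rintro u v ⟨u', u'', ⟨h1, h2⟩, a, b, d, ha, hb, hd, hd', e⟩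
      ⟨v', v'', ⟨k1, k2⟩, a₁, b₁, d₁, ka, kb, kd, kd', e₁⟩
    exact ⟨u' + v', u'' + v'', ⟨h1.add k1, h2.add k2⟩, a + a₁, b + b₁, d + d₁,
      tendsto_add_class ha ka, tendsto_add_class hb kb, tendsto_add_class hd kd,
      tendsto_add_class hd' kd', by linear_combination e + e₁⟩
  smul_mem' := by
    rintro c u ⟨u', u'', ⟨h1, h2⟩, a, b, d, ha, hb, hd, hd', e⟩
    exact ⟨c • u', c • u'', ⟨h1.const_smul c, h2.const_smul c⟩, c • a, c • b, c • d,
      tendsto_smul_class c ha, tendsto_smul_class c hb, tendsto_smul_class c hd,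
      tendsto_smul_class c hd', by simp only [smul_eq_mul]; linear_combination c * e⟩

theorem exists_second_deriv {γ : ℝ} (u : deltaPrimeDomain γ) :
    ∃ u'' : L2, ∃ u' : L2, IsH2With u u' u'' := by
  obtain ⟨_, u', u'', h, _⟩ := u
  exact ⟨u'', u', h⟩

/-- The second (weak) derivative, away from the origin, of an element of the domain of `H_γ`. -/
def secondDeriv {γ : ℝ} (u : deltaPrimeDomain γ) : L2 :=
  (exists_second_deriv u).choose

theorem secondDeriv_eq {γ : ℝ} {u : deltaPrimeDomain γ} {u' u'' : L2}
    (h : IsH2With u u' u'') : secondDeriv u = u'' := by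
  obtain ⟨v', hv⟩ := (exists_second_deriv u).choose_spec
  obtain rfl := hv.first.unique h.first
  exact hv.second.unique h.second

/-- The Hamiltonian `H_γ` of the `δ'` interaction, an unbounded operator in `L²(ℝ; ℂ)`:
`H_γ u = -u''` away from the origin. -/
def deltaPrimeHamiltonian (γ : ℝ) : L2 →ₗ.[ℂ] L2 where
  domain := deltaPrimeDomain γ
  toFun :=
    { toFun := fun u => -secondDeriv u
      map_add' := by
        intro u v
        obtain ⟨u', hu⟩ := (exists_second_deriv u).choose_spec
        obtain ⟨v', hv⟩ := (exists_second_deriv v).choose_spec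
        have h : IsH2With ((u + v : deltaPrimeDomain γ) : L2) (u' + v')
            (secondDeriv u + secondDeriv v) :=
          ⟨hu.first.add hv.first, hu.second.add hv.second⟩
        rw [secondDeriv_eq h, neg_add]
      map_smul' := by
        intro c u
        obtain ⟨u', hu⟩ := (exists_second_deriv u).choose_spec
        have h : IsH2With ((c • u : deltaPrimeDomain γ) : L2) (c • u') (c • secondDeriv u) :=
          ⟨hu.first.const_smul c, hu.second.const_smul c⟩
        rw [secondDeriv_eq h, smul_neg, RingHom.id_apply] }

/-! ### The linearized operator `L₁` -/

/-- The potential `(2 μ + 1) λ |ψ|^{2 μ}`. -/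
def linearizedPotential (μ lam : ℝ) (ψ : ℝ → ℂ) (x : ℝ) : ℂ :=
  (((2 * μ + 1) * lam * ‖ψ x‖ ^ (2 * μ) : ℝ) : ℂ)

/-- The operator `L₁ u = H_γ u + ω u - (2 μ + 1) λ |ψ|^{2 μ} u` on the domain of `H_γ`, for a
function `ψ` such that the potential is essentially bounded. -/
def linearizedL1 (γ ω μ lam : ℝ) (ψ : ℝ → ℂ)
    (hψ : MemLp (linearizedPotential μ lam ψ) ∞ volume) : L2 →ₗ.[ℂ] L2 where
  domain := (deltaPrimeHamiltonian γ).domain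
  toFun :=
    { toFun := fun u => deltaPrimeHamiltonian γ u + (ω : ℂ) • (u : L2)
        - (hψ.toLp (linearizedPotential μ lam ψ) • (u : L2) : L2)
      map_add' := by
        intro u v
        rw [LinearPMap.map_add, Submodule.coe_add, smul_add, Lp.add_smul]
        abel
      map_smul' := by
        intro c u
        rw [LinearPMap.map_smul, Submodule.coe_smul, RingHom.id_apply, smul_sub, smul_add,
          smul_comm c (ω : ℂ), Lp.smul_comm] }

/-- The eigenspace of an unbounded operator: all `u` in the domain with `L u = ν u`. For `ν = 0`
this is the kernel of `L`. -/
def eigenspaceOf (L : L2 →ₗ.[ℂ] L2) (ν : ℂ) : Submodule ℂ L.domain :=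
  LinearMap.ker (L.toFun - ν • L.domain.subtype)

/-! ### The asymmetric stationary states -/

/-- The frequency of bifurcation `ω* = (4 / γ²) (μ + 1) / μ`. -/
def omegaStar (γ μ : ℝ) : ℝ := 4 / γ ^ 2 * ((μ + 1) / μ)

/-- The soliton
`λ^{-1/(2μ)} (μ+1)^{1/(2μ)} ω^{1/(2μ)} sech^{1/μ} (μ √ω (x - x₀))` centred at `x₀`. -/
def soliton (ω μ lam x₀ x : ℝ) : ℝ :=
  lam ^ (-(1 / (2 * μ))) * (μ + 1) ^ (1 / (2 * μ)) * ω ^ (1 / (2 * μ)) *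
    (1 / Real.cosh (μ * √ω * (x - x₀))) ^ (1 / μ)

/-- The function equal to `-e^{iθ}` times the soliton centred at `x₁` on the negative half-line and
to `e^{iθ}` times the soliton centred at `x₂` on the positive half-line. -/
def solitonPair (ω μ lam x₁ x₂ θ x : ℝ) : ℂ :=
  if x < 0 then -Complex.exp (Complex.I * θ) * (soliton ω μ lam x₁ x : ℂ)
  else Complex.exp (Complex.I * θ) * (soliton ω μ lam x₂ x : ℂ)

/-- `(t₁, t₂)` with `0 < t₁ < t₂` solves the system
`t₁^{2μ} - t₁^{2μ+2} = t₂^{2μ} - t₂^{2μ+2}`, `t₁⁻¹ + t₂⁻¹ = γ √ω`. -/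
def IsAsymmetricSolution (γ ω μ t₁ t₂ : ℝ) : Prop :=
  0 < t₁ ∧ t₁ < t₂ ∧
    t₁ ^ (2 * μ) - t₁ ^ (2 * μ + 2) = t₂ ^ (2 * μ) - t₂ ^ (2 * μ + 2) ∧
    t₁⁻¹ + t₂⁻¹ = γ * √ω

/-- The number `y` with `tanh (μ √ω y) = t`, for `0 < t < 1`. -/
def centre (ω μ t : ℝ) : ℝ := 1 / (2 * μ * √ω) * Real.log |(1 + t) / (1 - t)|

/-- The state `ψ^{y₁, -y₂, θ}_ω` attached to the pair `(t₁, t₂)`. -/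
def asymmetricState (ω μ lam t₁ t₂ θ : ℝ) : ℝ → ℂ :=
  solitonPair ω μ lam (centre ω μ t₁) (-centre ω μ t₂) θ

/-! ### Boundedness of the potential -/

theorem norm_solitonPair (ω μ lam x₁ x₂ θ x : ℝ) :
    ‖solitonPair ω μ lam x₁ x₂ θ x‖ = |soliton ω μ lam (if x < 0 then x₁ else x₂) x| := by
  have h : ‖Complex.exp (Complex.I * θ)‖ = 1 := by
    rw [mul_comm]; exact Complex.norm_exp_ofReal_mul_I θ
  unfold solitonPair
  split_ifs <;> simp [h]

theorem abs_soliton_le {μ : ℝ} (hμ : 0 < μ) (ω lam x₀ x : ℝ) :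
    |soliton ω μ lam x₀ x| ≤
      |lam ^ (-(1 / (2 * μ))) * (μ + 1) ^ (1 / (2 * μ)) * ω ^ (1 / (2 * μ))| := by
  have h1 : 1 ≤ Real.cosh (μ * √ω * (x - x₀)) := Real.one_le_cosh _
  have h2 : |(1 / Real.cosh (μ * √ω * (x - x₀))) ^ (1 / μ)| ≤ 1 := by
    rw [abs_of_nonneg (by positivity)]
    exact Real.rpow_le_one (by positivity) ((div_le_one (by positivity)).2 h1) (by positivity)
  unfold soliton
  rw [abs_mul]
  exact mul_le_of_le_one_right (abs_nonneg _) h2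

theorem measurable_solitonPair (ω μ lam x₁ x₂ θ : ℝ) :
    Measurable (solitonPair ω μ lam x₁ x₂ θ) := by
  have h : ∀ x₀, Measurable (soliton ω μ lam x₀) := fun x₀ => by
    unfold soliton
    have : Measurable fun x : ℝ => Real.cosh (μ * √ω * (x - x₀)) :=
      (Real.continuous_cosh.comp (by fun_prop)).measurable
    fun_prop
  unfold solitonPair
  refine Measurable.ite measurableSet_Iio ?_ ?_
  · exact measurable_const.mul (Complex.measurable_ofReal.comp (h x₁))
  · exact measurable_const.mul (Complex.measurable_ofReal.comp (h x₂))

theorem memLp_linearizedPotential {μ : ℝ} (hμ : 0 < μ) (ω lam t₁ t₂ θ : ℝ) :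
    MemLp (linearizedPotential μ lam (asymmetricState ω μ lam t₁ t₂ θ)) ∞ volume := by
  set C := |lam ^ (-(1 / (2 * μ))) * (μ + 1) ^ (1 / (2 * μ)) * ω ^ (1 / (2 * μ))|
  refine memLp_top_of_bound (C := |(2 * μ + 1) * lam| * C ^ (2 * μ)) ?_ ?_
  · have h := (measurable_solitonPair ω μ lam (centre ω μ t₁) (-centre ω μ t₂) θ).norm
    refine (Complex.measurable_ofReal.comp ?_).aestronglyMeasurable
    exact (h.pow_const (2 * μ)).const_mul _
  · refine ae_of_all _ fun x => ?_
    have hb : ‖asymmetricState ω μ lam t₁ t₂ θ x‖ ≤ C := by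
      unfold asymmetricState
      rw [norm_solitonPair]
      exact abs_soliton_le hμ ω lam _ x
    rw [linearizedPotential, Complex.norm_real, norm_mul, Real.norm_eq_abs, Real.norm_eq_abs,
      abs_of_nonneg (Real.rpow_nonneg (norm_nonneg _) _)]
    gcongr

/-- The potential of `L₁` at `ψ^{y₁, -y₂, θ}_ω` in closed form: it is
`ω (μ + 1) (2 μ + 1) / cosh² (μ √ω (x - y₁))` for `x < 0` and
`ω (μ + 1) (2 μ + 1) / cosh² (μ √ω (x + y₂))` for `x > 0`. -/
theorem linearizedPotential_asymmetricState {ω μ lam : ℝ} (hω : 0 < ω) (hμ : 0 < μ)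
    (hlam : 0 < lam) (t₁ t₂ θ x : ℝ) :
    linearizedPotential μ lam (asymmetricState ω μ lam t₁ t₂ θ) x =
      ((ω * (μ + 1) * (2 * μ + 1) / Real.cosh (μ * √ω *
        (x + if x < 0 then -centre ω μ t₁ else centre ω μ t₂)) ^ 2 : ℝ) : ℂ) := by
  have key : ∀ x₀ : ℝ, |soliton ω μ lam x₀ x| ^ (2 * μ) =
      lam⁻¹ * (μ + 1) * ω / Real.cosh (μ * √ω * (x - x₀)) ^ 2 := fun x₀ => by
    have hc : 0 < Real.cosh (μ * √ω * (x - x₀)) := Real.cosh_pos _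
    unfold soliton
    rw [abs_of_nonneg (by positivity), Real.mul_rpow (by positivity) (by positivity),
      Real.mul_rpow (by positivity) (by positivity), Real.mul_rpow (by positivity) (by positivity),
      ← Real.rpow_mul hlam.le, ← Real.rpow_mul (by positivity), ← Real.rpow_mul hω.le,
      ← Real.rpow_mul (by positivity)]
    have e1 : -(1 / (2 * μ)) * (2 * μ) = -1 := by field_simp
    have e2 : 1 / (2 * μ) * (2 * μ) = 1 := by field_simp
    have e3 : 1 / μ * (2 * μ) = (2 : ℕ) := by field_simp; norm_num
    rw [e1, e2, e3, Real.rpow_neg_one, Real.rpow_one, Real.rpow_one, Real.rpow_natCast]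
    field_simp
  unfold linearizedPotential asymmetricState
  rw [norm_solitonPair, key]
  congr 1
  have e : x - (if x < 0 then centre ω μ t₁ else -centre ω μ t₂) =
      x + if x < 0 then -centre ω μ t₁ else centre ω μ t₂ := by
    split_ifs <;> ring
  rw [e]
  field_simp

end

/-!
Put `ν = ω - (μ √ω)² m²` with `m ≥ 1 / μ`, so that `m = 1 / μ` is the level `ν = 0`. On each
half-line `L₁ u = ν u` is a Pöschl–Teller equation in the variable `μ √ω x`, with a decaying Jost
solution. The Wronskian of this solution and a square integrable weak solution is constant and
integrable, hence zero, so every weak solution is a multiple of the Jost solution on each side.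
The `δ'` conditions at the origin then have a nonzero solution exactly when
`κ a b - (a + b) = 0`, where `κ = γ μ √ω` and `-a`, `-b` are the logarithmic derivatives of the
Jost solutions at `artanh t₁`, `artanh t₂`.

Sturm comparison, in the form of Picone's identity, shows that `a` and `b` increase strictly with
`m`. At `m = 1 / μ` the Jost solution is the explicit function `sech ^ (1 / μ) * tanh`, and the
equations for `(t₁, t₂)` give `a < 0 < b` and `1 / a + 1 / b < κ`; hence the determinant is negative
there, which excludes a kernel. For a zero at a larger `m` necessarily `a, b > 0`, where the
determinant has the sign of `κ - (1 / a + 1 / b)`, an increasing function of `m` that eventually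
becomes positive. So there is exactly one zero, and it is the negative eigenvalue.
-/

noncomputable section

/-! ### The curve `t₁ ^ (2 μ) - t₁ ^ (2 μ + 2) = t₂ ^ (2 μ) - t₂ ^ (2 μ + 2)` -/

theorem sinh_lt_mul_cosh {x : ℝ} (hx : 0 < x) : Real.sinh x < x * Real.cosh x := by
  obtain ⟨c, hc, hslope⟩ := exists_hasDerivAt_eq_slope Real.sinh Real.cosh hx
    Real.continuous_sinh.continuousOn fun y _ => Real.hasDerivAt_sinh y
  rw [Real.sinh_zero, sub_zero, sub_zero, eq_div_iff hx.ne'] at hslope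
  rw [← hslope, mul_comm]
  exact mul_lt_mul_of_pos_left (Real.cosh_strictMonoOn hc.1.le hx.le hc.2) hx

theorem two_mul_sinh_mul_cosh (a b : ℝ) :
    2 * (Real.sinh a * Real.cosh b) = Real.sinh (a + b) + Real.sinh (a - b) := by
  rw [Real.sinh_add, Real.sinh_sub]; ring

theorem mul_cosh_mul_sinh_lt {μ s : ℝ} (hμ : 0 < μ) (hs : 0 < s) :
    μ * Real.cosh ((μ + 1 / 2) * s) * Real.sinh ((μ + 1) * s) <
      (μ + 1) * Real.sinh (μ * s) * Real.cosh ((μ + 3 / 2) * s) := by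
  have hleft := two_mul_sinh_mul_cosh ((μ + 1) * s) ((μ + 1 / 2) * s)
  have hright := two_mul_sinh_mul_cosh (μ * s) ((μ + 3 / 2) * s)
  rw [show (μ + 1) * s + (μ + 1 / 2) * s = 2 * μ * s + 3 / 2 * s by ring,
    show (μ + 1) * s - (μ + 1 / 2) * s = 1 / 2 * s by ring] at hleft
  rw [show μ * s + (μ + 3 / 2) * s = 2 * μ * s + 3 / 2 * s by ring,
    show μ * s - (μ + 3 / 2) * s = -(3 / 2 * s) by ring, Real.sinh_neg] at hright
  have hsinh : 2 * μ * s * Real.cosh (3 / 2 * s) + Real.sinh (3 / 2 * s) ≤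
      Real.sinh (2 * μ * s + 3 / 2 * s) := by
    rw [Real.sinh_add]
    have : 0 ≤ Real.sinh (3 / 2 * s) := Real.sinh_nonneg_iff.2 (by positivity)
    exact add_le_add (mul_le_mul_of_nonneg_right (Real.self_le_sinh_iff.2 (by positivity))
      (Real.cosh_pos _).le) (le_mul_of_one_le_left this (Real.one_le_cosh _))
  have hlong : μ * Real.sinh (3 / 2 * s) < μ * (3 / 2 * s * Real.cosh (3 / 2 * s)) :=
    mul_lt_mul_of_pos_left (sinh_lt_mul_cosh (by positivity)) hμ
  have hshort : μ * Real.sinh (1 / 2 * s) < μ * (1 / 2 * s * Real.cosh (3 / 2 * s)) := by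
    refine mul_lt_mul_of_pos_left ((sinh_lt_mul_cosh (by positivity)).trans ?_) hμ
    refine mul_lt_mul_of_pos_left (Real.cosh_lt_cosh.2 ?_) (by positivity)
    rw [abs_of_pos (by positivity), abs_of_pos (by positivity)]
    linarith
  linear_combination (hsinh + hlong + hshort) / 2 + μ / 2 * hleft - (μ + 1) / 2 * hright

/-- The value of `(t₁⁻¹ + t₂⁻¹)² / 4` on the curve
`t₁ ^ (2 μ) - t₁ ^ (2 μ + 2) = t₂ ^ (2 μ) - t₂ ^ (2 μ + 2)`, as a function of
`s = log (t₂ / t₁)`. -/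
def curveFun (μ s : ℝ) : ℝ :=
  Real.cosh (s / 2) ^ 2 * Real.sinh ((μ + 1) * s) / Real.sinh (μ * s)

/-- The product `t₁ t₂` on the same curve. -/
def curveProd (μ s : ℝ) : ℝ := Real.sinh (μ * s) / Real.sinh ((μ + 1) * s)

section Curve

variable {γ ω μ c p s t₁ t₂ : ℝ}

theorem sinh_mul_pos (hμ : 0 < μ) (hs : 0 < s) : 0 < Real.sinh (μ * s) :=
  Real.sinh_pos_iff.2 (mul_pos hμ hs)

theorem curveProd_pos (hμ : 0 < μ) (hs : 0 < s) : 0 < curveProd μ s :=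
  div_pos (sinh_mul_pos hμ hs) (sinh_mul_pos (by positivity) hs)

theorem hasDerivAt_curveFun (hμ : 0 < μ) (hs : 0 < s) :
    HasDerivAt (curveFun μ)
      (Real.cosh (s / 2) * ((μ + 1) * Real.sinh (μ * s) * Real.cosh ((μ + 3 / 2) * s)
        - μ * Real.cosh ((μ + 1 / 2) * s) * Real.sinh ((μ + 1) * s)) /
          Real.sinh (μ * s) ^ 2) s := by
  have hcosh : HasDerivAt (fun s : ℝ => Real.cosh (s / 2)) (Real.sinh (s / 2) * (1 / 2)) s :=
    ((hasDerivAt_id s).div_const 2).cosh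
  have hsinh : ∀ a : ℝ, HasDerivAt (fun s : ℝ => Real.sinh (a * s))
      (Real.cosh (a * s) * (a * 1)) s := fun a => ((hasDerivAt_id s).const_mul a).sinh
  refine (((hcosh.pow 2).mul (hsinh (μ + 1))).div (hsinh μ)
    (sinh_mul_pos hμ hs).ne').congr_deriv ?_
  rw [show (μ + 3 / 2) * s = (μ + 1) * s + s / 2 by ring,
    show (μ + 1 / 2) * s = μ * s + s / 2 by ring, Real.cosh_add, Real.cosh_add]
  congr 1
  simp only [Pi.mul_apply, Pi.pow_apply]
  ring

theorem continuousOn_curveFun (hμ : 0 < μ) : ContinuousOn (curveFun μ) (Set.Ioi 0) :=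
  fun _ hs => (hasDerivAt_curveFun hμ hs).continuousAt.continuousWithinAt

theorem strictMonoOn_curveFun (hμ : 0 < μ) : StrictMonoOn (curveFun μ) (Set.Ioi 0) := by
  refine strictMonoOn_of_deriv_pos (convex_Ioi 0) (continuousOn_curveFun hμ) fun s hs => ?_
  rw [interior_Ioi, Set.mem_Ioi] at hs
  rw [(hasDerivAt_curveFun hμ hs).deriv]
  exact div_pos (mul_pos (Real.cosh_pos _) (sub_pos.2 (mul_cosh_mul_sinh_lt hμ hs)))
    (pow_pos (sinh_mul_pos hμ hs) 2)

theorem tendsto_inv_mul_sinh_mul (a : ℝ) :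
    Tendsto (fun s : ℝ => s⁻¹ * Real.sinh (a * s)) (𝓝[≠] 0) (𝓝 a) := by
  have hderiv : HasDerivAt (fun s : ℝ => Real.sinh (a * s)) a 0 := by
    simpa using ((hasDerivAt_id (0 : ℝ)).const_mul a).sinh
  simpa using hderiv.tendsto_slope_zero

theorem tendsto_curveFun_zero (hμ : 0 < μ) :
    Tendsto (curveFun μ) (𝓝[>] 0) (𝓝 ((μ + 1) / μ)) := by
  have hcosh : Tendsto (fun s : ℝ => Real.cosh (s / 2) ^ 2) (𝓝[>] 0) (𝓝 1) := by
    have : Continuous fun s : ℝ => Real.cosh (s / 2) ^ 2 := by fun_prop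
    simpa using (this.tendsto 0).mono_left nhdsWithin_le_nhds
  have hsinh : ∀ a : ℝ, Tendsto (fun s : ℝ => s⁻¹ * Real.sinh (a * s)) (𝓝[>] 0) (𝓝 a) :=
    fun a => (tendsto_inv_mul_sinh_mul a).mono_left
      (nhdsWithin_mono 0 fun _ hs => (Set.mem_Ioi.1 hs).ne')
  have hquot := (hcosh.mul (hsinh (μ + 1))).div (hsinh μ) hμ.ne'
  rw [one_mul] at hquot
  refine hquot.congr' ?_
  filter_upwards [self_mem_nhdsWithin] with s hs
  rw [Pi.div_apply, mul_left_comm, mul_div_mul_left _ _ (inv_ne_zero (Set.mem_Ioi.1 hs).ne'),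
    curveFun]

theorem half_le_curveFun (hμ : 0 < μ) (hs : 0 < s) : s / 2 ≤ curveFun μ s := by
  have hcosh : s / 2 ≤ Real.cosh (s / 2) ^ 2 :=
    calc s / 2 ≤ Real.cosh (s / 2) :=
          (Real.self_le_sinh_iff.2 (by positivity)).trans (Real.sinh_lt_cosh _).le
      _ ≤ Real.cosh (s / 2) ^ 2 := le_self_pow₀ (Real.one_le_cosh _) two_ne_zero
  have hsinh : Real.sinh (μ * s) ≤ Real.sinh ((μ + 1) * s) :=
    Real.sinh_le_sinh.2 (by nlinarith)
  rw [curveFun, le_div_iff₀ (sinh_mul_pos hμ hs)]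
  exact mul_le_mul hcosh hsinh (sinh_mul_pos hμ hs).le (by positivity)

theorem existsUnique_curveFun_eq (hμ : 0 < μ) (hc : (μ + 1) / μ < c) :
    ∃! s, 0 < s ∧ curveFun μ s = c := by
  obtain ⟨a, hac, ha⟩ := (((tendsto_curveFun_zero hμ).eventually (gt_mem_nhds hc)).and
    self_mem_nhdsWithin).exists
  have hb : c ≤ curveFun μ (max a (2 * c)) :=
    (by linarith [le_max_right a (2 * c)] : c ≤ max a (2 * c) / 2).trans
      (half_le_curveFun hμ (lt_max_of_lt_left ha))
  obtain ⟨s, hs, hsc⟩ := intermediate_value_Icc (le_max_left a (2 * c))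
    ((continuousOn_curveFun hμ).mono fun t ht => lt_of_lt_of_le ha ht.1) ⟨hac.le, hb⟩
  have hs0 : 0 < s := lt_of_lt_of_le ha hs.1
  exact ⟨s, ⟨hs0, hsc⟩, fun r ⟨hr, hrc⟩ =>
    (strictMonoOn_curveFun hμ).injOn hr hs0 (hrc.trans hsc.symm)⟩

theorem exists_eq_mul_exp (h₁ : 0 < t₁) (h₁₂ : t₁ < t₂) :
    ∃ p s : ℝ, 0 < p ∧ 0 < s ∧ t₁ = p * Real.exp (-(s / 2)) ∧ t₂ = p * Real.exp (s / 2) := by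
  have h₂ := h₁.trans h₁₂
  have hexp : Real.exp (Real.log (t₂ / t₁) / 2) = √t₂ / √t₁ := by
    rw [Real.exp_half, Real.exp_log (div_pos h₂ h₁), Real.sqrt_div h₂.le]
  refine ⟨√t₁ * √t₂, Real.log (t₂ / t₁), by positivity, Real.log_pos ((one_lt_div h₁).2 h₁₂),
    ?_, ?_⟩
  · rw [Real.exp_neg, hexp]
    field_simp
    exact (Real.sq_sqrt h₁.le).symm
  · rw [hexp]
    field_simp
    exact (Real.sq_sqrt h₂.le).symm

theorem rpow_sub_rpow_add_two {t : ℝ} (ht : 0 < t) :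
    t ^ (2 * μ) - t ^ (2 * μ + 2) = t ^ (2 * μ) * (1 - t ^ 2) := by
  rw [Real.rpow_add ht, Real.rpow_two]; ring

theorem rpow_sub_rpow_mul_exp (hp : 0 < p) (r : ℝ) :
    (p * Real.exp r) ^ (2 * μ) - (p * Real.exp r) ^ (2 * μ + 2) =
      p ^ (2 * μ) * (Real.exp (2 * r * μ) - p ^ 2 * Real.exp (2 * r * (μ + 1))) := by
  rw [rpow_sub_rpow_add_two (by positivity), Real.mul_rpow hp.le (Real.exp_pos r).le, mul_pow,
    ← Real.exp_mul, ← Real.exp_nat_mul, mul_assoc, mul_sub, mul_one, mul_left_comm _ (p ^ 2),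
    ← Real.exp_add]
  push_cast
  ring_nf

theorem curve_mul_exp_iff (hμ : 0 < μ) (hp : 0 < p) (hs : 0 < s) :
    (p * Real.exp (-(s / 2))) ^ (2 * μ) - (p * Real.exp (-(s / 2))) ^ (2 * μ + 2) =
      (p * Real.exp (s / 2)) ^ (2 * μ) - (p * Real.exp (s / 2)) ^ (2 * μ + 2) ↔
        p ^ 2 = curveProd μ s := by
  rw [rpow_sub_rpow_mul_exp hp, rpow_sub_rpow_mul_exp hp,
    mul_right_inj' (Real.rpow_pos_of_pos hp _).ne', curveProd,
    eq_div_iff (sinh_mul_pos (by positivity) hs).ne', Real.sinh_eq, Real.sinh_eq,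
    show 2 * -(s / 2) * μ = -(μ * s) by ring, show 2 * (s / 2) * μ = μ * s by ring,
    show 2 * -(s / 2) * (μ + 1) = -((μ + 1) * s) by ring,
    show 2 * (s / 2) * (μ + 1) = (μ + 1) * s by ring]
  constructor <;> intro h <;> linarith

theorem inv_add_inv_mul_exp (p s : ℝ) :
    (p * Real.exp (-(s / 2)))⁻¹ + (p * Real.exp (s / 2))⁻¹ = 2 * Real.cosh (s / 2) / p := by
  rw [mul_inv, mul_inv, ← Real.exp_neg, ← Real.exp_neg, neg_neg, Real.cosh_eq]
  ring

theorem isAsymmetricSolution_mul_exp_iff (hγ : 0 < γ) (hμ : 0 < μ) (hω : 0 ≤ ω) (hp : 0 < p)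
    (hs : 0 < s) :
    IsAsymmetricSolution γ ω μ (p * Real.exp (-(s / 2))) (p * Real.exp (s / 2)) ↔
      p ^ 2 = curveProd μ s ∧ curveFun μ s = γ ^ 2 * ω / 4 := by
  have hlt : p * Real.exp (-(s / 2)) < p * Real.exp (s / 2) :=
    mul_lt_mul_of_pos_left (Real.exp_lt_exp.2 (by linarith)) hp
  rw [IsAsymmetricSolution, curve_mul_exp_iff hμ hp hs, inv_add_inv_mul_exp,
    and_iff_right (by positivity), and_iff_right hlt]
  refine and_congr_right fun hprod => ?_
  have hcurve : curveFun μ s = (2 * Real.cosh (s / 2) / p) ^ 2 / 4 := by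
    rw [div_pow, hprod, curveFun, curveProd, div_div_eq_mul_div]
    ring
  rw [hcurve, div_left_inj' four_ne_zero, ← Real.sq_sqrt hω, ← mul_pow, Real.sq_sqrt hω,
    pow_left_inj₀ (by positivity) (by positivity) two_ne_zero]

theorem existsUnique_isAsymmetricSolution (hγ : 0 < γ) (hμ : 0 < μ) (hω : omegaStar γ μ < ω) :
    ∃! t : ℝ × ℝ, IsAsymmetricSolution γ ω μ t.1 t.2 := by
  have hω₀ : 0 < ω := lt_trans (by unfold omegaStar; positivity) hω
  have hc : (μ + 1) / μ < γ ^ 2 * ω / 4 := by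
    rw [omegaStar, div_mul_eq_mul_div, div_lt_iff₀ (by positivity)] at hω
    linarith
  obtain ⟨s, ⟨hs, hsc⟩, huniq⟩ := existsUnique_curveFun_eq hμ hc
  have hprod := curveProd_pos hμ hs
  refine ⟨(√(curveProd μ s) * Real.exp (-(s / 2)), √(curveProd μ s) * Real.exp (s / 2)),
    (isAsymmetricSolution_mul_exp_iff hγ hμ hω₀.le (Real.sqrt_pos.2 hprod) hs).2
      ⟨Real.sq_sqrt hprod.le, hsc⟩, ?_⟩
  rintro ⟨t₁, t₂⟩ h
  obtain ⟨p, r, hp, hr, rfl, rfl⟩ := exists_eq_mul_exp h.1 h.2.1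
  obtain ⟨hpr, hrc⟩ := (isAsymmetricSolution_mul_exp_iff hγ hμ hω₀.le hp hr).1 h
  obtain rfl := huniq r ⟨hr, hrc⟩
  rw [← hpr, Real.sqrt_sq hp.le]

theorem exists_sq_eq_of_rpow_sub_rpow_eq (h₁ : 0 < t₁) (h₁₂ : t₁ < t₂)
    (h : t₁ ^ (2 * μ) - t₁ ^ (2 * μ + 2) = t₂ ^ (2 * μ) - t₂ ^ (2 * μ + 2)) :
    ∃ t ∈ Set.Ioo t₁ t₂, (μ + 1) * t ^ 2 = μ := by
  have hderiv : ∀ t : ℝ, 0 < t → HasDerivAt (fun t : ℝ => t ^ (2 * μ) - t ^ (2 * μ + 2))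
      (2 * t ^ (2 * μ - 1) * (μ - (μ + 1) * t ^ 2)) t := fun t ht => by
    refine ((Real.hasDerivAt_rpow_const (Or.inl ht.ne')).sub
      (Real.hasDerivAt_rpow_const (Or.inl ht.ne'))).congr_deriv ?_
    rw [show 2 * μ + 2 - 1 = 2 * μ - 1 + 2 by ring, Real.rpow_add ht, Real.rpow_two]
    ring
  obtain ⟨t, ht, hzero⟩ := exists_hasDerivAt_eq_zero h₁₂
    (fun t ht => (hderiv t (h₁.trans_le ht.1)).continuousAt.continuousWithinAt) h
    fun t ht => hderiv t (h₁.trans ht.1)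
  have hpow : 0 < t ^ (2 * μ - 1) := Real.rpow_pos_of_pos (h₁.trans ht.1) _
  refine ⟨t, ht, ?_⟩
  linarith [(mul_eq_zero.1 hzero).resolve_left (by positivity)]

namespace IsAsymmetricSolution

theorem pos₂ (h : IsAsymmetricSolution γ ω μ t₁ t₂) : 0 < t₂ := h.1.trans h.2.1

theorem mul_sq_lt (hμ : 0 < μ) (h : IsAsymmetricSolution γ ω μ t₁ t₂) :
    (μ + 1) * t₁ ^ 2 < μ := by
  obtain ⟨t, ht, htμ⟩ := exists_sq_eq_of_rpow_sub_rpow_eq h.1 h.2.1 h.2.2.1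
  refine lt_of_lt_of_eq (mul_lt_mul_of_pos_left ?_ (by positivity)) htμ
  exact pow_lt_pow_left₀ ht.1 h.1.le two_ne_zero

theorem lt_mul_sq (hμ : 0 < μ) (h : IsAsymmetricSolution γ ω μ t₁ t₂) :
    μ < (μ + 1) * t₂ ^ 2 := by
  obtain ⟨t, ht, htμ⟩ := exists_sq_eq_of_rpow_sub_rpow_eq h.1 h.2.1 h.2.2.1
  refine lt_of_eq_of_lt htμ.symm (mul_lt_mul_of_pos_left ?_ (by positivity))
  exact pow_lt_pow_left₀ ht.2 (h.1.trans ht.1).le two_ne_zero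

theorem lt_one₁ (hμ : 0 < μ) (h : IsAsymmetricSolution γ ω μ t₁ t₂) : t₁ < 1 := by
  refine lt_of_pow_lt_pow_left₀ 2 zero_le_one (lt_of_mul_lt_mul_left ?_ (add_pos hμ one_pos).le)
  linarith [h.mul_sq_lt hμ]

theorem lt_one₂ (hμ : 0 < μ) (h : IsAsymmetricSolution γ ω μ t₁ t₂) : t₂ < 1 := by
  have hlevel := h.2.2.1
  rw [rpow_sub_rpow_add_two h.1, rpow_sub_rpow_add_two h.pos₂] at hlevel
  have hpos : 0 < t₁ ^ (2 * μ) * (1 - t₁ ^ 2) :=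
    mul_pos (Real.rpow_pos_of_pos h.1 _) (sub_pos.2 (pow_lt_one₀ h.1.le (h.lt_one₁ hμ) two_ne_zero))
  rw [hlevel] at hpos
  have hsq := pos_of_mul_pos_right hpos (Real.rpow_pos_of_pos h.pos₂ _).le
  exact lt_of_pow_lt_pow_left₀ 2 zero_le_one (by linarith)

end IsAsymmetricSolution

theorem one_sub_curveProd_mul_exp (hμ : 0 < μ) (hs : 0 < s) :
    1 - curveProd μ s * Real.exp s =
      Real.sinh s * Real.exp (-(μ * s)) / Real.sinh ((μ + 1) * s) := by
  have hS := (sinh_mul_pos (μ := μ + 1) (by positivity) hs).ne'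
  rw [curveProd, eq_div_iff hS, sub_mul, div_mul_eq_mul_div, div_mul_cancel₀ _ hS,
    show (μ + 1) * s = μ * s + s by ring, Real.sinh_add, ← Real.cosh_add_sinh s,
    ← Real.cosh_sub_sinh (μ * s)]
  ring

theorem one_sub_curveProd_mul_exp_neg (hμ : 0 < μ) (hs : 0 < s) :
    1 - curveProd μ s * Real.exp (-s) =
      Real.sinh s * Real.exp (μ * s) / Real.sinh ((μ + 1) * s) := by
  have hS := (sinh_mul_pos (μ := μ + 1) (by positivity) hs).ne'
  rw [curveProd, eq_div_iff hS, sub_mul, div_mul_eq_mul_div, div_mul_cancel₀ _ hS,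
    show (μ + 1) * s = μ * s + s by ring, Real.sinh_add, ← Real.cosh_sub_sinh s,
    ← Real.cosh_add_sinh (μ * s)]
  ring

namespace IsAsymmetricSolution

/-- Up to a positive factor the left-hand side is the derivative of `curveFun μ` at
`log (t₂ / t₁)`. -/
theorem slope_numerator_pos (hγ : 0 < γ) (hμ : 0 < μ) (hω : 0 ≤ ω)
    (h : IsAsymmetricSolution γ ω μ t₁ t₂) :
    0 < (1 - t₁ ^ 2) * t₂ * ((μ + 1) * t₂ ^ 2 - μ) +
      (1 - t₂ ^ 2) * t₁ * ((μ + 1) * t₁ ^ 2 - μ) := by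
  obtain ⟨p, s, hp, hs, h₁, h₂⟩ := exists_eq_mul_exp h.1 h.2.1
  have hprod : p ^ 2 = curveProd μ s :=
    ((isAsymmetricSolution_mul_exp_iff hγ hμ hω hp hs).1 (h₁ ▸ h₂ ▸ h)).1
  have hsq₁ : t₁ ^ 2 = curveProd μ s * Real.exp (-s) := by
    rw [h₁, mul_pow, hprod, ← Real.exp_nat_mul]; push_cast; ring_nf
  have hsq₂ : t₂ ^ 2 = curveProd μ s * Real.exp s := by
    rw [h₂, mul_pow, hprod, ← Real.exp_nat_mul]; push_cast; ring_nf
  have hfactor : (1 - t₁ ^ 2) * t₂ * ((μ + 1) * t₂ ^ 2 - μ) +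
      (1 - t₂ ^ 2) * t₁ * ((μ + 1) * t₁ ^ 2 - μ) =
      2 * Real.sinh s * p / Real.sinh ((μ + 1) * s) ^ 2 *
        ((μ + 1) * Real.sinh (μ * s) * Real.cosh ((μ + 3 / 2) * s) -
          μ * Real.cosh ((μ + 1 / 2) * s) * Real.sinh ((μ + 1) * s)) := by
    rw [hsq₁, hsq₂, one_sub_curveProd_mul_exp hμ hs, one_sub_curveProd_mul_exp_neg hμ hs, h₁, h₂,
      curveProd, Real.cosh_eq, Real.cosh_eq, show (μ + 3 / 2) * s = μ * s + s + s / 2 by ring,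
      show (μ + 1 / 2) * s = μ * s + s / 2 by ring, neg_add, neg_add, neg_add]
    simp only [Real.exp_add]
    field_simp
    ring
  rw [hfactor]
  have := sinh_mul_pos (μ := μ + 1) (by positivity) hs
  have := Real.sinh_pos_iff.2 hs
  have := sub_pos.2 (mul_cosh_mul_sinh_lt hμ hs)
  positivity

theorem div_add_div_lt (hγ : 0 < γ) (hμ : 0 < μ) (hω : 0 ≤ ω)
    (h : IsAsymmetricSolution γ ω μ t₁ t₂) :
    t₁ / ((μ + 1) * t₁ ^ 2 - μ) + t₂ / ((μ + 1) * t₂ ^ 2 - μ) < γ * √ω := by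
  have h₁ : (μ + 1) * t₁ ^ 2 - μ < 0 := sub_neg.2 (h.mul_sq_lt hμ)
  have h₂ : 0 < (μ + 1) * t₂ ^ 2 - μ := sub_pos.2 (h.lt_mul_sq hμ)
  have hdiff : ∀ t : ℝ, 0 < t → (μ + 1) * t ^ 2 - μ ≠ 0 → t / ((μ + 1) * t ^ 2 - μ) - t⁻¹ =
      μ * (1 - t ^ 2) / (t * ((μ + 1) * t ^ 2 - μ)) := fun t ht hne => by
    rw [eq_div_iff (mul_ne_zero ht.ne' hne), sub_mul, mul_comm t, ← mul_assoc,
      div_mul_cancel₀ _ hne]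
    field_simp
    ring
  rw [← h.2.2.2, ← sub_neg, add_sub_add_comm, hdiff t₁ h.1 h₁.ne, hdiff t₂ h.pos₂ h₂.ne',
    div_add_div _ _ (mul_ne_zero h.1.ne' h₁.ne) (mul_ne_zero h.pos₂.ne' h₂.ne')]
  refine div_neg_of_pos_of_neg ?_ (mul_neg_of_neg_of_pos (mul_neg_of_pos_of_neg h.1 h₁)
    (mul_pos h.pos₂ h₂))
  linear_combination μ * h.slope_numerator_pos hγ hμ hω

end IsAsymmetricSolution

end Curve

/-! ### Power series with polynomially bounded coefficients -/

section PowerSeries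

variable {a : ℕ → ℝ} {w : ℝ}

/-- The coefficients of a power series grow at most polynomially. This class is stable under
differentiation, and its power series converge on the unit disc. -/
def PolyBounded (a : ℕ → ℝ) : Prop := ∃ p : ℕ, a =O[atTop] fun n => (n : ℝ) ^ p

/-- The sum of the power series with coefficients `a`. -/
def powerSum (a : ℕ → ℝ) (w : ℝ) : ℝ := ∑' n, a n * w ^ n

/-- The coefficients of the derivative of the power series with coefficients `a`. -/
def derivCoeff (a : ℕ → ℝ) (n : ℕ) : ℝ := (n + 1) * a (n + 1)

theorem PolyBounded.nat_mul (ha : PolyBounded a) : PolyBounded fun n => n * a n := by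
  obtain ⟨p, ha⟩ := ha
  refine ⟨p + 1, ((Asymptotics.isBigO_refl (fun n : ℕ => (n : ℝ)) atTop).mul ha).congr_right ?_⟩
  exact fun n => (pow_succ' _ _).symm

theorem PolyBounded.shift (ha : PolyBounded a) : PolyBounded fun n => a (n + 1) := by
  obtain ⟨p, ha⟩ := ha
  refine ⟨p, (ha.comp_tendsto (tendsto_add_atTop_nat 1)).trans (.of_bound (2 ^ p) ?_)⟩
  filter_upwards [eventually_ge_atTop 1] with n hn
  have hn' : (1 : ℝ) ≤ n := mod_cast hn
  rw [Function.comp_apply, norm_pow, norm_pow, ← mul_pow, Real.norm_natCast, Real.norm_natCast]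
  gcongr
  push_cast
  linarith

theorem PolyBounded.deriv (ha : PolyBounded a) : PolyBounded (derivCoeff a) := by
  convert ha.nat_mul.shift using 2 with n
  push_cast [derivCoeff]
  rfl

theorem hasSum_of_succ {f : ℕ → ℝ} {s : ℝ} (h₀ : f 0 = 0) (h : HasSum (fun n => f (n + 1)) s) :
    HasSum f s := by
  simpa [h₀] using h.zero_add

theorem PolyBounded.summable_abs (ha : PolyBounded a) (hw : |w| < 1) :
    Summable fun n => |a n| * |w| ^ n := by
  obtain ⟨p, ha⟩ := ha
  refine summable_of_isBigO_nat (summable_pow_mul_geometric_of_norm_lt_one p (r := |w|) ?_)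
    (ha.abs_left.mul (Asymptotics.isBigO_refl _ _))
  rwa [Real.norm_eq_abs, abs_abs]

theorem PolyBounded.summable (ha : PolyBounded a) (hw : |w| < 1) :
    Summable fun n => a n * w ^ n :=
  .of_abs <| (ha.summable_abs hw).congr fun n => by rw [abs_mul, abs_pow]

theorem PolyBounded.hasSum (ha : PolyBounded a) (hw : |w| < 1) :
    HasSum (fun n => a n * w ^ n) (powerSum a w) :=
  (ha.summable hw).hasSum

theorem PolyBounded.hasSum_mul_powerSum_derivCoeff (ha : PolyBounded a) (hw : |w| < 1) :
    HasSum (fun n => n * a n * w ^ n) (w * powerSum (derivCoeff a) w) := by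
  refine hasSum_of_succ (by simp) (((ha.deriv.hasSum hw).mul_left w).congr_fun fun n => ?_)
  push_cast [derivCoeff]
  ring

theorem PolyBounded.hasDerivAt_powerSum (ha : PolyBounded a) (hw : |w| < 1) :
    HasDerivAt (powerSum a) (powerSum (derivCoeff a) w) w := by
  obtain ⟨r, hwr, hr1⟩ := exists_between hw
  have hr0 : 0 < r := (abs_nonneg w).trans_lt hwr
  have hbound : Summable fun n : ℕ => |a n| * (n * r ^ (n - 1)) := by
    refine (summable_nat_add_iff 1).1 ((ha.deriv.summable_abs
      (by rwa [abs_of_pos hr0] : |r| < 1)).congr fun n => ?_)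
    rw [derivCoeff, abs_mul, abs_of_pos hr0, abs_of_pos n.cast_add_one_pos]
    push_cast
    ring
  have hderiv := hasDerivAt_tsum_of_isPreconnected (g := fun n w => a n * w ^ n)
    (g' := fun n w => a n * (n * w ^ (n - 1))) (y₀ := 0) (y := w) hbound
    (Metric.isOpen_ball (x := 0) (ε := r)) (convex_ball 0 r).isPreconnected
    (fun n y _ => (hasDerivAt_pow n y).const_mul (a n))
    (fun n y hy => by
      rw [mem_ball_zero_iff, Real.norm_eq_abs] at hy
      rw [norm_mul, norm_mul, norm_pow, Real.norm_natCast, Real.norm_eq_abs, Real.norm_eq_abs]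
      gcongr)
    (Metric.mem_ball_self hr0) (ha.summable (by simp)) (by simpa using hwr)
  refine hderiv.congr_deriv (HasSum.tsum_eq ?_)
  refine hasSum_of_succ (by simp) ((ha.deriv.hasSum hw).congr_fun fun n => ?_)
  push_cast [derivCoeff, Nat.add_sub_cancel]
  ring

end PowerSeries

/-! ### The hypergeometric series -/

section Hypergeometric

variable {Λ m w : ℝ}

/-- The Taylor coefficients of the hypergeometric function `₂F₁(-l, l + 1; 1 + m; w)`, where
`l (l + 1) = Λ`. -/
def hyperCoeff (Λ m : ℝ) : ℕ → ℝ
  | 0 => 1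
  | n + 1 => hyperCoeff Λ m n * ((n * (n + 1) - Λ) / ((n + 1) * (n + 1 + m)))

theorem hyperCoeff_succ (hm : 0 ≤ m) (n : ℕ) :
    (n + 1) * (n + 1 + m) * hyperCoeff Λ m (n + 1) = (n * (n + 1) - Λ) * hyperCoeff Λ m n := by
  rw [hyperCoeff]
  field

theorem abs_hyperCoeff_factor_le (hΛ : 0 ≤ Λ) (hm : 0 ≤ m) (n : ℕ) :
    |(n * (n + 1) - Λ) / ((n + 1) * (n + 1 + m))| ≤ if Λ ≤ n then 1 else 1 + Λ := by
  have hn : (0 : ℝ) ≤ n := n.cast_nonneg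
  have hden : (n + 1 : ℝ) * (n + 1) ≤ (n + 1) * (n + 1 + m) :=
    mul_le_mul_of_nonneg_left (le_add_of_nonneg_right hm) (by positivity)
  rw [abs_div, abs_of_pos (by positivity : (0 : ℝ) < (n + 1) * (n + 1 + m)),
    div_le_iff₀ (by positivity)]
  split_ifs with hΛn
  · rw [abs_le]
    constructor <;> nlinarith
  · calc |(n * (n + 1) - Λ : ℝ)| ≤ |(n * (n + 1) : ℝ)| + |Λ| := abs_sub _ _
      _ ≤ (1 + Λ) * ((n + 1) * (n + 1)) := by
        rw [abs_of_nonneg hΛ, abs_of_nonneg (by positivity)]; nlinarith [mul_nonneg hΛ hn]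
      _ ≤ (1 + Λ) * ((n + 1) * (n + 1 + m)) := by gcongr

theorem abs_hyperCoeff_le (hΛ : 0 ≤ Λ) (hm : 0 ≤ m) (n : ℕ) :
    |hyperCoeff Λ m n| ≤ (1 + Λ) ^ ⌈Λ⌉₊ := by
  suffices |hyperCoeff Λ m n| ≤ (1 + Λ) ^ min n ⌈Λ⌉₊ from
    this.trans (pow_le_pow_right₀ (by linarith) (min_le_right _ _))
  induction n with
  | zero => simp [hyperCoeff]
  | succ n ih =>
    have hfactor := abs_hyperCoeff_factor_le hΛ hm n
    rw [hyperCoeff, abs_mul]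
    split_ifs at hfactor with hΛn
    · have hn := Nat.ceil_le.2 hΛn
      rw [min_eq_right hn] at ih
      rw [min_eq_right (hn.trans n.le_succ)]
      exact (mul_le_of_le_one_right (abs_nonneg _) hfactor).trans ih
    · have hn := Nat.lt_ceil.2 (not_le.1 hΛn)
      rw [min_eq_left hn.le] at ih
      rw [min_eq_left hn, pow_succ]
      gcongr

theorem polyBounded_hyperCoeff (hΛ : 0 ≤ Λ) (hm : 0 ≤ m) : PolyBounded (hyperCoeff Λ m) :=
  ⟨0, .of_bound _ (.of_forall fun n => by simpa using abs_hyperCoeff_le hΛ hm n)⟩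

theorem continuousOn_hyperCoeff (n : ℕ) :
    ContinuousOn (fun m => hyperCoeff Λ m n) (Set.Ici 0) := by
  induction n with
  | zero => exact continuousOn_const
  | succ n ih =>
    refine ih.mul (continuousOn_const.div (by fun_prop) fun m hm => ?_)
    rw [Set.mem_Ici] at hm
    positivity

/-- The hypergeometric function `₂F₁(-l, l + 1; 1 + m; w)`, where `l (l + 1) = Λ`. -/
def hyperSum (Λ m : ℝ) : ℝ → ℝ := powerSum (hyperCoeff Λ m)

/-- The derivative of `hyperSum Λ m`. -/
def hyperSum' (Λ m : ℝ) : ℝ → ℝ := powerSum (derivCoeff (hyperCoeff Λ m))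

/-- The second derivative of `hyperSum Λ m`. -/
def hyperSum'' (Λ m : ℝ) : ℝ → ℝ := powerSum (derivCoeff (derivCoeff (hyperCoeff Λ m)))

theorem hyperSum_zero : hyperSum Λ m 0 = 1 := by
  rw [hyperSum, powerSum, tsum_eq_single 0 fun n hn => by rw [zero_pow hn, mul_zero]]
  simp [hyperCoeff]

theorem hasDerivAt_hyperSum (hΛ : 0 ≤ Λ) (hm : 0 ≤ m) (hw : |w| < 1) :
    HasDerivAt (hyperSum Λ m) (hyperSum' Λ m w) w :=
  (polyBounded_hyperCoeff hΛ hm).hasDerivAt_powerSum hw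

theorem hasDerivAt_hyperSum' (hΛ : 0 ≤ Λ) (hm : 0 ≤ m) (hw : |w| < 1) :
    HasDerivAt (hyperSum' Λ m) (hyperSum'' Λ m w) w :=
  (polyBounded_hyperCoeff hΛ hm).deriv.hasDerivAt_powerSum hw

theorem hyperSum_ode (hΛ : 0 ≤ Λ) (hm : 0 ≤ m) (hw : |w| < 1) :
    w * (1 - w) * hyperSum'' Λ m w + (m + 1 - 2 * w) * hyperSum' Λ m w + Λ * hyperSum Λ m w =
      0 := by
  set c := hyperCoeff Λ m
  have hc : PolyBounded c := polyBounded_hyperCoeff hΛ hm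
  have hS : HasSum (fun n => c n * w ^ n) (hyperSum Λ m w) := hc.hasSum hw
  have hS' : HasSum (fun n => derivCoeff c n * w ^ n) (hyperSum' Λ m w) := hc.deriv.hasSum hw
  have hwS' : HasSum (fun n => n * c n * w ^ n) (w * hyperSum' Λ m w) :=
    hc.hasSum_mul_powerSum_derivCoeff hw
  have hwS'' : HasSum (fun n => n * derivCoeff c n * w ^ n) (w * hyperSum'' Λ m w) :=
    hc.deriv.hasSum_mul_powerSum_derivCoeff hw
  have hwwS'' : HasSum (fun n => (n * (n * c n) - n * c n) * w ^ n)
      (w * (w * hyperSum'' Λ m w)) := by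
    refine hasSum_of_succ (by simp) ((hwS''.mul_left w).congr_fun fun n => ?_)
    push_cast [derivCoeff]
    ring
  have hsum := (((hwS''.sub hwwS'').add (hS'.mul_left (m + 1))).sub (hwS'.mul_left 2)).add
    (hS.mul_left Λ)
  have hterm : ∀ n : ℕ, n * derivCoeff c n * w ^ n - (n * (n * c n) - n * c n) * w ^ n +
      (m + 1) * (derivCoeff c n * w ^ n) - 2 * (n * c n * w ^ n) + Λ * (c n * w ^ n) = 0 := by
    intro n
    rw [derivCoeff]
    linear_combination w ^ n * hyperCoeff_succ (Λ := Λ) hm n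
  simp only [hterm] at hsum
  linear_combination hsum.unique hasSum_zero

theorem continuousOn_tsum_mul_hyperCoeff (hΛ : 0 ≤ Λ) {b : ℕ → ℝ} (hb : Summable fun n => |b n|)
    (k : ℕ) : ContinuousOn (fun m => ∑' n, b n * hyperCoeff Λ m (n + k)) (Set.Ici 0) := by
  refine continuousOn_tsum (fun n => continuousOn_const.mul (continuousOn_hyperCoeff (n + k)))
    (hb.mul_right ((1 + Λ) ^ ⌈Λ⌉₊)) fun n m hm => ?_
  rw [norm_mul, Real.norm_eq_abs, Real.norm_eq_abs]
  gcongr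
  exact abs_hyperCoeff_le hΛ hm _

theorem continuousOn_hyperSum (hΛ : 0 ≤ Λ) (hw : |w| < 1) :
    ContinuousOn (fun m => hyperSum Λ m w) (Set.Ici 0) := by
  have hb : Summable fun n => |w ^ n| := by
    simpa only [abs_pow] using summable_geometric_of_lt_one (abs_nonneg w) hw
  refine (continuousOn_tsum_mul_hyperCoeff hΛ hb 0).congr fun m _ => tsum_congr fun n => ?_
  rw [mul_comm, add_zero]

theorem continuousOn_hyperSum' (hΛ : 0 ≤ Λ) (hw : |w| < 1) :
    ContinuousOn (fun m => hyperSum' Λ m w) (Set.Ici 0) := by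
  have hone : PolyBounded fun _ => (1 : ℝ) :=
    ⟨0, by simpa using Asymptotics.isBigO_refl (fun _ : ℕ => (1 : ℝ)) atTop⟩
  have hb : Summable fun n => |derivCoeff (fun _ => 1) n * w ^ n| := by
    simpa only [abs_mul, abs_pow] using hone.deriv.summable_abs hw
  refine (continuousOn_tsum_mul_hyperCoeff hΛ hb 1).congr fun m _ => tsum_congr fun n => ?_
  rw [derivCoeff, derivCoeff]
  ring

end Hypergeometric

/-! ### Jost solutions and Sturm comparison -/

section Jost

/-- `f`, with derivative `f'`, is the Jost solution of `f'' = q f` at energy `-m ^ 2`: it is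
asymptotic to `exp (-m z)` at infinity, together with its derivative. -/
structure IsJost (q : ℝ → ℝ) (m : ℝ) (f f' : ℝ → ℝ) : Prop where
  hasDerivAt : ∀ z, HasDerivAt f (f' z) z
  hasDerivAt' : ∀ z, HasDerivAt f' (q z * f z) z
  tendsto : Tendsto (fun z => Real.exp (m * z) * f z) atTop (𝓝 1)
  tendsto' : Tendsto (fun z => Real.exp (m * z) * f' z) atTop (𝓝 (-m))

theorem exp_mul_exp_neg_mul (a b : ℝ) : Real.exp a * (Real.exp (-a) * b) = b := by
  rw [Real.exp_neg, mul_inv_cancel_left₀ (Real.exp_ne_zero a)]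

theorem hasDerivAt_exp_neg_mul (m z : ℝ) :
    HasDerivAt (fun z => Real.exp (-(m * z))) (-m * Real.exp (-(m * z))) z := by
  simpa [mul_comm] using (((hasDerivAt_id z).const_mul m).neg).exp

theorem isJost_exp (k : ℝ) : IsJost (fun _ => k ^ 2) k (fun z => Real.exp (-(k * z)))
    (fun z => -k * Real.exp (-(k * z))) where
  hasDerivAt := hasDerivAt_exp_neg_mul k
  hasDerivAt' z := ((hasDerivAt_exp_neg_mul k z).const_mul (-k)).congr_deriv (by ring)
  tendsto := tendsto_const_nhds.congr fun z => by
    rw [← Real.exp_add, add_neg_cancel, Real.exp_zero]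
  tendsto' := tendsto_const_nhds.congr fun z => by
    rw [mul_comm (-k), exp_mul_exp_neg_mul]

theorem tendsto_zero_of_tendsto_exp_mul {m l : ℝ} {h : ℝ → ℝ} (hm : 0 < m)
    (hh : Tendsto (fun z => Real.exp (m * z) * h z) atTop (𝓝 l)) : Tendsto h atTop (𝓝 0) := by
  have hexp : Tendsto (fun z => Real.exp (-(m * z))) atTop (𝓝 0) :=
    Real.tendsto_exp_neg_atTop_nhds_zero.comp (tendsto_id.const_mul_atTop hm)
  refine zero_mul l ▸ (hexp.mul hh).congr fun z => ?_
  rw [← mul_assoc, ← Real.exp_add, neg_add_cancel, Real.exp_zero, one_mul]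

namespace IsJost

variable {q r f f' g g' : ℝ → ℝ} {m k z₀ z : ℝ}

theorem continuous (hf : IsJost q m f f') : Continuous f :=
  continuous_iff_continuousAt.2 fun z => (hf.hasDerivAt z).continuousAt

theorem continuous' (hf : IsJost q m f f') : Continuous f' :=
  continuous_iff_continuousAt.2 fun z => (hf.hasDerivAt' z).continuousAt

theorem tendsto_zero (hf : IsJost q m f f') (hm : 0 < m) : Tendsto f atTop (𝓝 0) :=
  tendsto_zero_of_tendsto_exp_mul hm hf.tendsto

theorem tendsto_zero' (hf : IsJost q m f f') (hm : 0 < m) : Tendsto f' atTop (𝓝 0) :=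
  tendsto_zero_of_tendsto_exp_mul hm hf.tendsto'

theorem eventually_pos (hf : IsJost q m f f') : ∀ᶠ z in atTop, 0 < f z := by
  filter_upwards [hf.tendsto.eventually (lt_mem_nhds one_pos)] with z hz
  exact pos_of_mul_pos_right hz (Real.exp_pos _).le

theorem tendsto_logDeriv (hf : IsJost q m f f') :
    Tendsto (fun z => f' z / f z) atTop (𝓝 (-m)) := by
  refine div_one (-m) ▸ (hf.tendsto'.div hf.tendsto one_ne_zero).congr fun z => ?_
  exact mul_div_mul_left _ _ (Real.exp_ne_zero _)

/-- The function differentiated in Picone's identity. -/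
def picone (f f' g g' : ℝ → ℝ) (z : ℝ) : ℝ := f z * f' z - f z ^ 2 * (g' z / g z)

theorem hasDerivAt_picone (hf : IsJost q m f f') (hg : IsJost r k g g') (hgz : g z ≠ 0) :
    HasDerivAt (picone f f' g g')
      ((f' z - f z * (g' z / g z)) ^ 2 + (q z - r z) * f z ^ 2) z := by
  refine (((hf.hasDerivAt z).mul (hf.hasDerivAt' z)).sub (((hf.hasDerivAt z).pow 2).mul
    ((hg.hasDerivAt' z).div (hg.hasDerivAt z) hgz))).congr_deriv ?_
  simp only [Pi.pow_apply, Pi.div_apply]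
  field

theorem tendsto_picone (hf : IsJost q m f f') (hg : IsJost r k g g') (hm : 0 < m) :
    Tendsto (picone f f' g g') atTop (𝓝 0) := by
  unfold picone
  simpa using ((hf.tendsto_zero hm).mul (hf.tendsto_zero' hm)).sub
    (((hf.tendsto_zero hm).pow 2).mul hg.tendsto_logDeriv)

theorem picone_neg (hf : IsJost q m f f') (hg : IsJost r k g g') (hm : 0 < m)
    (hrq : ∀ z, z₀ ≤ z → r z < q z) (hpos : ∀ z, z₀ ≤ z → 0 < g z) (hz : z₀ ≤ z) :
    picone f f' g g' z < 0 := by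
  have hderiv : ∀ t, z₀ ≤ t → HasDerivAt (picone f f' g g') _ t := fun t ht =>
    hf.hasDerivAt_picone hg (hpos t ht).ne'
  have hcont : ContinuousOn (picone f f' g g') (Set.Ici z₀) := fun t ht =>
    (hderiv t ht).continuousAt.continuousWithinAt
  have hmono : MonotoneOn (picone f f' g g') (Set.Ici z₀) := by
    refine monotoneOn_of_hasDerivWithinAt_nonneg (convex_Ici z₀) hcont
      (fun t ht => (hderiv t (interior_subset ht)).hasDerivWithinAt) fun t ht => ?_
    have := sub_pos.2 (hrq t (interior_subset ht))
    positivity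
  obtain ⟨T, hT⟩ := eventually_atTop.1 hf.eventually_pos
  have hsub : Set.Ici (max T z) ⊆ Set.Ici z₀ := Set.Ici_subset_Ici.2 (hz.trans (le_max_right T z))
  have hstrict : StrictMonoOn (picone f f' g g') (Set.Ici (max T z)) := by
    refine strictMonoOn_of_hasDerivWithinAt_pos (convex_Ici _) (hcont.mono hsub)
      (fun t ht => (hderiv t (hsub (interior_subset ht))).hasDerivWithinAt) fun t ht => ?_
    have := sub_pos.2 (hrq t (hsub (interior_subset ht)))
    have := hT t ((le_max_left T z).trans (interior_subset ht))
    positivity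
  have hle : ∀ t, z₀ ≤ t → picone f f' g g' t ≤ 0 := fun t ht =>
    ge_of_tendsto (hf.tendsto_picone hg hm)
      ((eventually_ge_atTop t).mono fun s hs => hmono ht (ht.trans hs) hs)
  have hlt := lt_add_one (max T z)
  calc picone f f' g g' z ≤ picone f f' g g' (max T z) :=
        hmono hz (hsub Set.self_mem_Ici) (le_max_right T z)
    _ < picone f f' g g' (max T z + 1) := hstrict Set.self_mem_Ici hlt.le hlt
    _ ≤ 0 := hle _ (hsub hlt.le)

theorem pos_of_lt (hf : IsJost q m f f') (hg : IsJost r k g g') (hm : 0 < m)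
    (hrq : ∀ z, z₀ ≤ z → r z < q z) (hpos : ∀ z, z₀ ≤ z → 0 < g z) (hz : z₀ ≤ z) : 0 < f z := by
  by_contra! hneg
  obtain ⟨t, htz, htf⟩ := ((eventually_ge_atTop z).and hf.eventually_pos).exists
  obtain ⟨s, hs, hs0⟩ := intermediate_value_Icc htz hf.continuous.continuousOn ⟨hneg, htf.le⟩
  have := hf.picone_neg hg hm hrq hpos (hz.trans hs.1)
  simp [picone, hs0] at this

theorem logDeriv_lt_of_lt (hf : IsJost q m f f') (hg : IsJost r k g g') (hm : 0 < m)
    (hrq : ∀ z, z₀ ≤ z → r z < q z) (hpos : ∀ z, z₀ ≤ z → 0 < g z) (hz : z₀ ≤ z) :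
    f' z / f z < g' z / g z := by
  have hfz := hf.pos_of_lt hg hm hrq hpos hz
  have hneg := hf.picone_neg hg hm hrq hpos hz
  rw [picone, show f z * f' z - f z ^ 2 * (g' z / g z) = f z * (f' z - f z * (g' z / g z)) by ring]
    at hneg
  rw [div_lt_iff₀ hfz, mul_comm]
  linarith [neg_of_mul_neg_right hneg hfz.le]

theorem wronskian_eq_zero (hf : IsJost q m f f') (hg : IsJost q m g g') (hm : 0 < m) (z : ℝ) :
    f' z * g z - f z * g' z = 0 := by
  have hderiv : ∀ t, HasDerivAt (fun t => f' t * g t - f t * g' t) 0 t := fun t =>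
    (((hf.hasDerivAt' t).mul (hg.hasDerivAt t)).sub
      ((hf.hasDerivAt t).mul (hg.hasDerivAt' t))).congr_deriv (by ring)
  have hlim : Tendsto (fun t => f' t * g t - f t * g' t) atTop (𝓝 0) := by
    simpa using ((hf.tendsto_zero' hm).mul (hg.tendsto_zero hm)).sub
      ((hf.tendsto_zero hm).mul (hg.tendsto_zero' hm))
  exact tendsto_nhds_unique (tendsto_const_nhds.congr fun t => is_const_of_deriv_eq_zero
    (fun t => (hderiv t).differentiableAt) (fun t => (hderiv t).deriv) z t) hlim

theorem eq_of_pos (hf : IsJost q m f f') (hg : IsJost q m g g') (hm : 0 < m)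
    (hpos : ∀ z, z₀ < z → 0 < g z) (hz : z₀ < z) : f z = g z ∧ f' z = g' z := by
  have hderiv : ∀ t, z₀ < t → HasDerivAt (fun t => f t / g t) 0 t := fun t ht =>
    ((hf.hasDerivAt t).div (hg.hasDerivAt t) (hpos t ht).ne').congr_deriv (by
      rw [hf.wronskian_eq_zero hg hm, zero_div])
  have hlim : Tendsto (fun t => f t / g t) atTop (𝓝 1) :=
    div_one (1 : ℝ) ▸ (hf.tendsto.div hg.tendsto one_ne_zero).congr fun t =>
      mul_div_mul_left _ _ (Real.exp_ne_zero _)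
  have hconst : ∀ t, z₀ < t → f z / g z = f t / g t := fun t ht =>
    isOpen_Ioi.is_const_of_deriv_eq_zero (convex_Ioi z₀).isPreconnected
      (fun s hs => (hderiv s hs).differentiableAt.differentiableWithinAt)
      (fun s hs => (hderiv s hs).deriv) hz ht
  have hquot : f z / g z = 1 := tendsto_nhds_unique
    (tendsto_const_nhds.congr' ((eventually_gt_atTop z₀).mono hconst)) hlim
  have hfg : f z = g z := (div_eq_one_iff_eq (hpos z hz).ne').1 hquot
  refine ⟨hfg, mul_right_cancel₀ (hpos z hz).ne' ?_⟩
  have := hf.wronskian_eq_zero hg hm z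
  rw [hfg] at this
  linarith

end IsJost

end Jost

/-! ### The Pöschl–Teller equation -/

section PoschlTeller

variable {Λ m m₀ z : ℝ}

/-- The coefficient `q` of the Pöschl–Teller equation `f'' = q f` with coupling `Λ` at energy
`-m ^ 2`. -/
def poschlTeller (Λ m z : ℝ) : ℝ := m ^ 2 - Λ / Real.cosh z ^ 2

theorem hasDerivAt_tanh (z : ℝ) : HasDerivAt Real.tanh (1 - Real.tanh z ^ 2) z := by
  have hcosh := (Real.cosh_pos z).ne'
  rw [funext Real.tanh_eq_sinh_div_cosh]
  exact ((Real.hasDerivAt_sinh z).div (Real.hasDerivAt_cosh z) hcosh).congr_deriv (by field)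

theorem inv_cosh_sq (z : ℝ) : (Real.cosh z ^ 2)⁻¹ = 1 - Real.tanh z ^ 2 := by
  have hcosh := (Real.cosh_pos z).ne'
  rw [Real.tanh_eq_sinh_div_cosh, div_pow, Real.sinh_sq]
  field

theorem tendsto_tanh_atTop : Tendsto Real.tanh atTop (𝓝 1) := by
  have hlim : Tendsto (fun z => 2 * Real.sigmoid (2 * z) - 1) atTop (𝓝 1) := by
    have := ((Real.tendsto_sigmoid_atTop.comp
      (tendsto_id.const_mul_atTop (two_pos (α := ℝ)))).const_mul 2).sub_const 1
    rwa [show (2 * 1 - 1 : ℝ) = 1 by norm_num] at this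
  refine hlim.congr fun z => ?_
  rw [Real.tanh_eq, Real.sigmoid_def, two_mul z, neg_add, Real.exp_add, Real.exp_neg]
  field

theorem tanh_pos (hz : 0 < z) : 0 < Real.tanh z := by
  rw [Real.tanh_eq_sinh_div_cosh]
  exact div_pos (Real.sinh_pos_iff.2 hz) (Real.cosh_pos z)

/-- The variable in which the Pöschl–Teller equation becomes hypergeometric. -/
def hyperVar (z : ℝ) : ℝ := (1 - Real.tanh z) / 2

theorem abs_hyperVar_lt_one (z : ℝ) : |hyperVar z| < 1 := by
  rw [hyperVar, abs_lt]
  constructor <;> linarith [Real.neg_one_lt_tanh z, Real.tanh_lt_one z]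

theorem hasDerivAt_hyperVar (z : ℝ) :
    HasDerivAt hyperVar (-(2 * hyperVar z * (1 - hyperVar z))) z := by
  refine (((hasDerivAt_tanh z).const_sub 1).div_const 2).congr_deriv ?_
  rw [hyperVar]
  ring

theorem tendsto_hyperVar : Tendsto hyperVar atTop (𝓝 0) := by
  unfold hyperVar
  simpa using (tendsto_tanh_atTop.const_sub 1).div_const 2

/-- The Jost solution of the Pöschl–Teller equation. -/
def jost (Λ m z : ℝ) : ℝ := Real.exp (-(m * z)) * hyperSum Λ m (hyperVar z)

/-- The derivative of the Jost solution. -/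
def jost' (Λ m z : ℝ) : ℝ :=
  Real.exp (-(m * z)) * (-(m * hyperSum Λ m (hyperVar z)) -
    2 * hyperVar z * (1 - hyperVar z) * hyperSum' Λ m (hyperVar z))

theorem hasDerivAt_jost (hΛ : 0 ≤ Λ) (hm : 0 ≤ m) (z : ℝ) :
    HasDerivAt (jost Λ m) (jost' Λ m z) z := by
  refine ((hasDerivAt_exp_neg_mul m z).mul
    ((hasDerivAt_hyperSum hΛ hm (abs_hyperVar_lt_one z)).comp z
      (hasDerivAt_hyperVar z))).congr_deriv ?_
  rw [jost', Function.comp_apply]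
  ring

theorem hasDerivAt_jost' (hΛ : 0 ≤ Λ) (hm : 0 ≤ m) (z : ℝ) :
    HasDerivAt (jost' Λ m) (poschlTeller Λ m z * jost Λ m z) z := by
  have hw := hasDerivAt_hyperVar z
  have hS := (hasDerivAt_hyperSum hΛ hm (abs_hyperVar_lt_one z)).comp z hw
  have hS' := (hasDerivAt_hyperSum' hΛ hm (abs_hyperVar_lt_one z)).comp z hw
  refine ((hasDerivAt_exp_neg_mul m z).mul (((hS.const_mul m).neg).sub
    (((hw.const_mul 2).mul (hw.const_sub 1)).mul hS'))).congr_deriv ?_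
  have hsech : (Real.cosh z ^ 2)⁻¹ = 4 * hyperVar z * (1 - hyperVar z) := by
    rw [inv_cosh_sq, hyperVar]; ring
  rw [poschlTeller, jost, div_eq_mul_inv, hsech]
  simp only [Function.comp_apply, Pi.mul_apply, Pi.sub_apply, Pi.neg_apply]
  linear_combination (4 * Real.exp (-(m * z)) * hyperVar z * (1 - hyperVar z)) *
    hyperSum_ode hΛ hm (abs_hyperVar_lt_one z)

theorem isJost_jost (hΛ : 0 ≤ Λ) (hm : 0 ≤ m) :
    IsJost (poschlTeller Λ m) m (jost Λ m) (jost' Λ m) := by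
  have hS : Tendsto (fun z => hyperSum Λ m (hyperVar z)) atTop (𝓝 1) := by
    have := (hasDerivAt_hyperSum (w := 0) hΛ hm (by simp)).continuousAt.tendsto
    exact (hyperSum_zero ▸ this).comp tendsto_hyperVar
  have hS' : Tendsto (fun z => hyperSum' Λ m (hyperVar z)) atTop (𝓝 (hyperSum' Λ m 0)) :=
    (hasDerivAt_hyperSum' (w := 0) hΛ hm (by simp)).continuousAt.tendsto.comp tendsto_hyperVar
  refine ⟨hasDerivAt_jost hΛ hm, hasDerivAt_jost' hΛ hm, ?_, ?_⟩
  · exact hS.congr fun z => (exp_mul_exp_neg_mul _ _).symm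
  · have hlim := ((hS.const_mul m).neg).sub
      (((tendsto_hyperVar.const_mul 2).mul (tendsto_hyperVar.const_sub 1)).mul hS')
    simp only [mul_one, mul_zero, zero_mul, sub_zero] at hlim
    exact hlim.congr fun z => (exp_mul_exp_neg_mul _ _).symm

theorem continuousOn_jost (hΛ : 0 ≤ Λ) (z : ℝ) :
    ContinuousOn (fun m => jost Λ m z) (Set.Ici 0) :=
  (by fun_prop : Continuous fun m : ℝ => Real.exp (-(m * z))).continuousOn.mul
    (continuousOn_hyperSum hΛ (abs_hyperVar_lt_one z))

theorem continuousOn_jost' (hΛ : 0 ≤ Λ) (z : ℝ) :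
    ContinuousOn (fun m => jost' Λ m z) (Set.Ici 0) := by
  have hS := continuousOn_hyperSum hΛ (abs_hyperVar_lt_one z)
  have hS' := continuousOn_hyperSum' hΛ (abs_hyperVar_lt_one z)
  unfold jost'
  fun_prop

/-- The coupling for which `sech ^ m₀ * tanh` is the Jost solution at energy `-m₀ ^ 2`. -/
def ptCoupling (m₀ : ℝ) : ℝ := (1 + m₀) * (2 + m₀)

theorem ptCoupling_nonneg (hm₀ : 0 ≤ m₀) : 0 ≤ ptCoupling m₀ := by
  unfold ptCoupling
  positivity

/-- The function `(2 cosh z) ^ (-m)`, with its exponential decay split off. -/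
def sechPow (m z : ℝ) : ℝ := Real.exp (-(m * z)) * ((1 + Real.tanh z) / 2) ^ m

theorem half_one_add_tanh_pos (z : ℝ) : 0 < (1 + Real.tanh z) / 2 := by
  linarith [Real.neg_one_lt_tanh z]

theorem sechPow_pos (m z : ℝ) : 0 < sechPow m z :=
  mul_pos (Real.exp_pos _) (Real.rpow_pos_of_pos (half_one_add_tanh_pos z) _)

theorem hasDerivAt_sechPow (m z : ℝ) :
    HasDerivAt (sechPow m) (-(m * Real.tanh z) * sechPow m z) z := by
  have hpos := half_one_add_tanh_pos z
  refine ((hasDerivAt_exp_neg_mul m z).mul ((((hasDerivAt_tanh z).const_add 1).div_const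
    2).rpow_const (p := m) (.inl hpos.ne'))).congr_deriv ?_
  have : 1 + Real.tanh z ≠ 0 := by linarith
  rw [Real.rpow_sub_one hpos.ne', sechPow]
  field

theorem tendsto_exp_mul_sechPow (m : ℝ) :
    Tendsto (fun z => Real.exp (m * z) * sechPow m z) atTop (𝓝 1) := by
  have hbase : Tendsto (fun z => (1 + Real.tanh z) / 2) atTop (𝓝 1) := by
    simpa using (tendsto_tanh_atTop.const_add 1).div_const 2
  have hlim := hbase.rpow_const (p := m) (.inl one_ne_zero)
  rw [Real.one_rpow] at hlim
  exact hlim.congr fun z => (exp_mul_exp_neg_mul _ _).symm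

theorem isJost_sechPow_mul_tanh (m : ℝ) : IsJost (poschlTeller (ptCoupling m) m) m
    (fun z => sechPow m z * Real.tanh z)
    (fun z => sechPow m z * (1 - (m + 1) * Real.tanh z ^ 2)) where
  hasDerivAt z := ((hasDerivAt_sechPow m z).mul (hasDerivAt_tanh z)).congr_deriv (by ring)
  hasDerivAt' z := by
    refine ((hasDerivAt_sechPow m z).mul
      ((((hasDerivAt_tanh z).pow 2).const_mul (m + 1)).const_sub 1)).congr_deriv ?_
    rw [poschlTeller, ptCoupling, div_eq_mul_inv, inv_cosh_sq]
    simp only [Pi.pow_apply]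
    ring
  tendsto := mul_one (1 : ℝ) ▸
    ((tendsto_exp_mul_sechPow m).mul tendsto_tanh_atTop).congr fun z => mul_assoc _ _ _
  tendsto' := by
    have hlim := (tendsto_exp_mul_sechPow m).mul
      (((tendsto_tanh_atTop.pow 2).const_mul (m + 1)).const_sub 1)
    rw [show (1 : ℝ) * (1 - (m + 1) * 1 ^ 2) = -m by ring] at hlim
    exact hlim.congr fun z => mul_assoc _ _ _

end PoschlTeller

/-! ### Slopes of the Jost solutions and the matching determinant -/

section JostSlope

variable {Λ m₀ m k z : ℝ}

/-- The logarithmic derivative of the Jost solution, with the opposite sign. -/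
def jostSlope (Λ m z : ℝ) : ℝ := -(jost' Λ m z / jost Λ m z)

theorem jost_self (hm : 0 < m) (hz : 0 < z) :
    jost (ptCoupling m) m z = sechPow m z * Real.tanh z ∧
      jost' (ptCoupling m) m z = sechPow m z * (1 - (m + 1) * Real.tanh z ^ 2) :=
  (isJost_jost (ptCoupling_nonneg hm.le) hm.le).eq_of_pos (isJost_sechPow_mul_tanh m) hm
    (fun t ht => mul_pos (sechPow_pos m t) (tanh_pos ht)) hz

theorem jostSlope_self (hm : 0 < m) (hz : 0 < z) :
    jostSlope (ptCoupling m) m z = ((m + 1) * Real.tanh z ^ 2 - 1) / Real.tanh z := by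
  rw [jostSlope, (jost_self hm hz).1, (jost_self hm hz).2,
    mul_div_mul_left _ _ (sechPow_pos m z).ne', ← neg_div, neg_sub]

theorem poschlTeller_lt_poschlTeller (hk : 0 ≤ k) (hkm : k < m) :
    poschlTeller Λ k z < poschlTeller Λ m z :=
  sub_lt_sub_right (pow_lt_pow_left₀ hkm hk two_ne_zero) _

theorem jost_pos (hm₀ : 0 < m₀) (hm : m₀ ≤ m) (hz : 0 < z) : 0 < jost (ptCoupling m₀) m z := by
  have hΛ := ptCoupling_nonneg hm₀.le
  have hpos : ∀ t, z ≤ t → 0 < jost (ptCoupling m₀) m₀ t := fun t ht => by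
    rw [(jost_self hm₀ (hz.trans_le ht)).1]
    exact mul_pos (sechPow_pos m₀ t) (tanh_pos (hz.trans_le ht))
  rcases hm.eq_or_lt with rfl | hlt
  · exact hpos z le_rfl
  · exact (isJost_jost hΛ (hm₀.le.trans hm)).pos_of_lt (isJost_jost hΛ hm₀.le)
      (hm₀.trans_le hm) (fun t _ => poschlTeller_lt_poschlTeller hm₀.le hlt) hpos le_rfl

theorem strictMonoOn_jostSlope (hm₀ : 0 < m₀) (hz : 0 < z) :
    StrictMonoOn (fun m => jostSlope (ptCoupling m₀) m z) (Set.Ici m₀) := by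
  intro k hk m _ hkm
  have hΛ := ptCoupling_nonneg hm₀.le
  have hk₀ : 0 < k := hm₀.trans_le hk
  exact neg_lt_neg <| (isJost_jost hΛ (hk₀.le.trans hkm.le)).logDeriv_lt_of_lt
    (isJost_jost hΛ hk₀.le) (hk₀.trans hkm)
    (fun t _ => poschlTeller_lt_poschlTeller hk₀.le hkm)
    (fun t ht => jost_pos hm₀ hk (hz.trans_le ht)) le_rfl

theorem continuousOn_jostSlope (hm₀ : 0 < m₀) (hz : 0 < z) :
    ContinuousOn (fun m => jostSlope (ptCoupling m₀) m z) (Set.Ici m₀) := by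
  have hΛ := ptCoupling_nonneg hm₀.le
  have hsub : Set.Ici m₀ ⊆ Set.Ici 0 := Set.Ici_subset_Ici.2 hm₀.le
  exact (((continuousOn_jost' hΛ z).mono hsub).div ((continuousOn_jost hΛ z).mono hsub)
    fun m hm => (jost_pos hm₀ hm hz).ne').neg

theorem tendsto_jostSlope (hΛ : 0 ≤ Λ) (z : ℝ) :
    Tendsto (fun m => jostSlope Λ m z) atTop atTop := by
  refine tendsto_atTop.2 fun b => ?_
  filter_upwards [eventually_gt_atTop 0,
    (tendsto_pow_atTop two_ne_zero).eventually_gt_atTop (b ^ 2 + Λ)] with m hm hbm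
  have hlt : ∀ t, z ≤ t → b ^ 2 < poschlTeller Λ m t := fun t _ => by
    have : Λ / Real.cosh t ^ 2 ≤ Λ := div_le_self hΛ (one_le_pow₀ (Real.one_le_cosh t))
    rw [poschlTeller]
    linarith
  have hslope := (isJost_jost hΛ hm.le).logDeriv_lt_of_lt (isJost_exp b) hm hlt
    (fun t _ => Real.exp_pos _) le_rfl
  rw [mul_div_cancel_right₀ _ (Real.exp_ne_zero _)] at hslope
  exact (lt_neg_of_lt_neg hslope).le

end JostSlope

section MatchDet

variable {κ a b a₀ b₀ m₀ z₁ z₂ : ℝ} {s₁ s₂ : ℝ → ℝ}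

/-- The determinant of the matching conditions at a `δ'`-interaction of strength `κ` between two
functions of slopes `a` and `b`. -/
def matchDet (κ a b : ℝ) : ℝ := κ * (a * b) - (a + b)

theorem matchDet_eq (ha : a ≠ 0) (hb : b ≠ 0) :
    matchDet κ a b = a * b * (κ - (a⁻¹ + b⁻¹)) := by
  rw [matchDet]
  field

theorem matchDet_neg (ha : a < 0) (hb : 0 < b) (hκ : a⁻¹ + b⁻¹ < κ) : matchDet κ a b < 0 := by
  rw [matchDet_eq ha.ne hb.ne']
  exact mul_neg_of_neg_of_pos (mul_neg_of_neg_of_pos ha hb) (sub_pos.2 hκ)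

theorem matchDet_pos (hκ : 0 < κ) (ha : 2 / κ < a) (hb : 2 / κ < b) : 0 < matchDet κ a b := by
  have hκ' : 0 < 2 / κ := div_pos two_pos hκ
  have ha' := mul_lt_mul_of_pos_left ((div_lt_iff₀ hκ).1 ha) (hκ'.trans hb)
  have hb' := mul_lt_mul_of_pos_left ((div_lt_iff₀ hκ).1 hb) (hκ'.trans ha)
  rw [matchDet]
  linarith

theorem pos_of_matchDet_eq_zero (ha₀ : a₀ < 0) (hb₀ : 0 < b₀) (hκ : a₀⁻¹ + b₀⁻¹ < κ)
    (ha : a₀ < a) (hb : b₀ < b) (h : matchDet κ a b = 0) : 0 < a := by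
  have hb0 := hb₀.trans hb
  rcases lt_trichotomy a 0 with ha0 | rfl | ha0
  · have hinv := add_lt_add ((inv_lt_inv_of_neg ha0 ha₀).2 ha) ((inv_lt_inv₀ hb0 hb₀).2 hb)
    exact absurd h (matchDet_neg ha0 hb0 (hinv.trans hκ)).ne
  · simp only [matchDet, zero_mul, mul_zero, zero_add, zero_sub, neg_eq_zero] at h
    exact absurd h hb0.ne'
  · exact ha0

theorem matchDet_ne_zero_of_lt (ha₀ : 0 < a₀) (hb₀ : 0 < b₀) (ha : a₀ < a) (hb : b₀ < b)
    (h : matchDet κ a₀ b₀ = 0) : matchDet κ a b ≠ 0 := by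
  have ha' := ha₀.trans ha
  have hb' := hb₀.trans hb
  rw [matchDet_eq ha₀.ne' hb₀.ne', mul_eq_zero, or_iff_right (mul_pos ha₀ hb₀).ne',
    sub_eq_zero] at h
  rw [matchDet_eq ha'.ne' hb'.ne', h]
  have hinv := add_lt_add ((inv_lt_inv₀ ha' ha₀).2 ha) ((inv_lt_inv₀ hb' hb₀).2 hb)
  exact (mul_pos (mul_pos ha' hb') (sub_pos.2 hinv)).ne'

theorem existsUnique_matchDet_eq_zero
    (hs₁ : StrictMonoOn s₁ (Set.Ici m₀)) (hs₂ : StrictMonoOn s₂ (Set.Ici m₀))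
    (hc₁ : ContinuousOn s₁ (Set.Ici m₀)) (hc₂ : ContinuousOn s₂ (Set.Ici m₀))
    (hl₁ : Tendsto s₁ atTop atTop) (hl₂ : Tendsto s₂ atTop atTop)
    (hneg : s₁ m₀ < 0) (hpos : 0 < s₂ m₀) (hκ₀ : 0 < κ) (hκ : (s₁ m₀)⁻¹ + (s₂ m₀)⁻¹ < κ) :
    ∃! m, m₀ < m ∧ matchDet κ (s₁ m) (s₂ m) = 0 := by
  obtain ⟨M, ⟨hM₁, hM₂⟩, hM⟩ := ((hl₁.eventually_gt_atTop (2 / κ)).and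
    (hl₂.eventually_gt_atTop (2 / κ))).and (eventually_gt_atTop m₀) |>.exists
  have hcont : ContinuousOn (fun m => matchDet κ (s₁ m) (s₂ m)) (Set.Icc m₀ M) :=
    ((continuousOn_const.mul (hc₁.mul hc₂)).sub (hc₁.add hc₂)).mono Set.Icc_subset_Ici_self
  obtain ⟨m, hm, hm0⟩ := intermediate_value_Ioo hM.le hcont
    ⟨matchDet_neg hneg hpos hκ, matchDet_pos hκ₀ hM₁ hM₂⟩
  have hne : ∀ k l, m₀ < k → k < l → matchDet κ (s₁ k) (s₂ k) = 0 →
      matchDet κ (s₁ l) (s₂ l) ≠ 0 := fun k l hk hkl hk0 =>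
    have h₁ := hs₁ Set.self_mem_Ici hk.le hk
    have h₂ := hs₂ Set.self_mem_Ici hk.le hk
    matchDet_ne_zero_of_lt (pos_of_matchDet_eq_zero hneg hpos hκ h₁ h₂ hk0) (hpos.trans h₂)
      (hs₁ hk.le (hk.trans hkl).le hkl) (hs₂ hk.le (hk.trans hkl).le hkl) hk0
  refine ⟨m, ⟨hm.1, hm0⟩, fun n ⟨hn, hn0⟩ => ?_⟩
  rcases lt_trichotomy n m with h | h | h
  · exact absurd hm0 (hne n m hn h hn0)
  · exact h
  · exact absurd hn0 (hne m n hm.1 h hm0)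

theorem existsUnique_matchDet_jostSlope_eq_zero (hm₀ : 0 < m₀) (hz₁ : 0 < z₁) (hz₂ : 0 < z₂)
    (hneg : jostSlope (ptCoupling m₀) m₀ z₁ < 0) (hpos : 0 < jostSlope (ptCoupling m₀) m₀ z₂)
    (hκ₀ : 0 < κ) (hκ : (jostSlope (ptCoupling m₀) m₀ z₁)⁻¹ +
      (jostSlope (ptCoupling m₀) m₀ z₂)⁻¹ < κ) :
    ∃! m, m₀ < m ∧
      matchDet κ (jostSlope (ptCoupling m₀) m z₁) (jostSlope (ptCoupling m₀) m z₂) = 0 :=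
  have hΛ := ptCoupling_nonneg hm₀.le
  existsUnique_matchDet_eq_zero (strictMonoOn_jostSlope hm₀ hz₁) (strictMonoOn_jostSlope hm₀ hz₂)
    (continuousOn_jostSlope hm₀ hz₁) (continuousOn_jostSlope hm₀ hz₂)
    (tendsto_jostSlope hΛ z₁) (tendsto_jostSlope hΛ z₂) hneg hpos hκ₀ hκ

end MatchDet

/-! ### Weak derivatives on open sets -/

section WeakDeriv

variable {E : Type*} [NormedAddCommGroup E] [NormedSpace ℝ E] {U : Set ℝ} {f f' f₁ g g₁ : ℝ → E}
  {φ a a' : ℝ → ℝ}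

/-- `g` is the weak derivative of `f` on `U`; for `U = {0}ᶜ` and `L²` functions this unfolds to
`IsWeakDeriv`. -/
def HasWeakDerivOn (U : Set ℝ) (f g : ℝ → E) : Prop :=
  ∀ φ : ℝ → ℝ, ContDiff ℝ (⊤ : ℕ∞) φ → HasCompactSupport φ → tsupport φ ⊆ U →
    ∫ x, deriv φ x • f x = -∫ x, φ x • g x

theorem IsWeakDeriv.hasWeakDerivOn {f g : L2} (h : IsWeakDeriv f g) (hU : (0 : ℝ) ∉ U) :
    HasWeakDerivOn U f g :=
  fun φ hφ hc hs => h φ hφ hc (hs.trans (Set.subset_compl_singleton_iff.2 hU))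

theorem integrable_smul_of_tsupport_subset (hf : LocallyIntegrableOn f U) (hφ : Continuous φ)
    (hc : HasCompactSupport φ) (hs : tsupport φ ⊆ U) : Integrable fun x => φ x • f x :=
  (integrableOn_iff_integrable_of_support_subset
    ((Function.support_smul_subset_left φ f).trans (subset_tsupport φ))).1
    ((hf.integrableOn_compact_subset hs hc).continuousOn_smul hφ.continuousOn hc)

theorem integrable_deriv_smul_of_tsupport_subset (hf : LocallyIntegrableOn f U)
    (hφ : ContDiff ℝ (⊤ : ℕ∞) φ) (hc : HasCompactSupport φ) (hs : tsupport φ ⊆ U) :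
    Integrable fun x => deriv φ x • f x :=
  integrable_smul_of_tsupport_subset hf (hφ.continuous_deriv (by simp)) hc.deriv
    ((tsupport_deriv_subset (𝕜 := ℝ)).trans hs)

theorem eventuallyEq_smul_zero_of_notMem_tsupport {x : ℝ} (hx : x ∉ tsupport φ) :
    (fun x => φ x • f x) =ᶠ[𝓝 x] 0 := by
  filter_upwards [notMem_tsupport_iff_eventuallyEq.1 hx] with y hy
  rw [hy, Pi.zero_apply, zero_smul, Pi.zero_apply]

theorem hasDerivAt_smul_of_tsupport_subset (hφ : Differentiable ℝ φ) (hs : tsupport φ ⊆ U)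
    (hf : ∀ x ∈ U, HasDerivAt f (f' x) x) (x : ℝ) :
    HasDerivAt (fun x => φ x • f x) (φ x • f' x + deriv φ x • f x) x := by
  by_cases hx : x ∈ tsupport φ
  · exact (hφ x).hasDerivAt.smul (hf x (hs hx))
  · rw [image_eq_zero_of_notMem_tsupport hx, zero_smul,
      image_eq_zero_of_notMem_tsupport fun h => hx (tsupport_deriv_subset (𝕜 := ℝ) h), zero_smul,
      add_zero]
    exact (hasDerivAt_const x (0 : E)).congr_of_eventuallyEq
      (eventuallyEq_smul_zero_of_notMem_tsupport hx)

theorem contDiff_mul_of_tsupport_subset (hU : IsOpen U) (ha : ContDiffOn ℝ (⊤ : ℕ∞) a U)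
    (hφ : ContDiff ℝ (⊤ : ℕ∞) φ) (hs : tsupport φ ⊆ U) :
    ContDiff ℝ (⊤ : ℕ∞) fun x => φ x * a x := by
  refine contDiff_iff_contDiffAt.2 fun x => ?_
  by_cases hx : x ∈ tsupport φ
  · exact hφ.contDiffAt.mul (ha.contDiffAt (hU.mem_nhds (hs hx)))
  · exact contDiffAt_const.congr_of_eventuallyEq (eventuallyEq_smul_zero_of_notMem_tsupport hx)

theorem continuousOn_of_hasDerivAt (hU : IsOpen U) (ha : ContDiffOn ℝ (⊤ : ℕ∞) a U)
    (ha' : ∀ x ∈ U, HasDerivAt a (a' x) x) : ContinuousOn a' U :=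
  (ha.continuousOn_deriv_of_isOpen hU (by simp)).congr fun x hx => (ha' x hx).deriv.symm

namespace HasWeakDerivOn

theorem of_hasDerivAt (hU : IsOpen U) (h : ∀ x ∈ U, HasDerivAt f (f' x) x)
    (hf' : LocallyIntegrableOn f' U) : HasWeakDerivOn U f f' := by
  intro φ hφ hc hs
  have hf : LocallyIntegrableOn f U :=
    ContinuousOn.locallyIntegrableOn (fun x hx => (h x hx).continuousAt.continuousWithinAt)
      hU.measurableSet
  have i := integrable_smul_of_tsupport_subset hf' hφ.continuous hc hs
  have i' := integrable_deriv_smul_of_tsupport_subset hf hφ hc hs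
  have key := integral_eq_zero_of_hasDerivAt_of_integrable
    (hasDerivAt_smul_of_tsupport_subset (hφ.differentiable (by simp)) hs h) (i.add i')
    (integrable_smul_of_tsupport_subset hf hφ.continuous hc hs)
  rw [integral_add i i'] at key
  exact eq_neg_of_add_eq_zero_right key

theorem congr_right (h : HasWeakDerivOn U f g) (hg : ∀ᵐ x, x ∈ U → g x = g₁ x) :
    HasWeakDerivOn U f g₁ := by
  intro φ hφ hc hs
  rw [h φ hφ hc hs]
  refine congrArg _ (integral_congr_ae ?_)
  filter_upwards [hg] with x hx
  by_cases hxφ : x ∈ tsupport φ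
  · rw [hx (hs hxφ)]
  · rw [image_eq_zero_of_notMem_tsupport hxφ, zero_smul, zero_smul]

theorem sub (h : HasWeakDerivOn U f g) (h₁ : HasWeakDerivOn U f₁ g₁)
    (hf : LocallyIntegrableOn f U) (hf₁ : LocallyIntegrableOn f₁ U)
    (hg : LocallyIntegrableOn g U) (hg₁ : LocallyIntegrableOn g₁ U) :
    HasWeakDerivOn U (fun x => f x - f₁ x) fun x => g x - g₁ x := by
  intro φ hφ hc hs
  simp only [smul_sub]
  rw [integral_sub (integrable_deriv_smul_of_tsupport_subset hf hφ hc hs)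
      (integrable_deriv_smul_of_tsupport_subset hf₁ hφ hc hs),
    integral_sub (integrable_smul_of_tsupport_subset hg hφ.continuous hc hs)
      (integrable_smul_of_tsupport_subset hg₁ hφ.continuous hc hs),
    h φ hφ hc hs, h₁ φ hφ hc hs]
  abel

theorem smul (h : HasWeakDerivOn U f g) (hU : IsOpen U) (ha : ContDiffOn ℝ (⊤ : ℕ∞) a U)
    (ha' : ∀ x ∈ U, HasDerivAt a (a' x) x) (hf : LocallyIntegrableOn f U)
    (hg : LocallyIntegrableOn g U) :
    HasWeakDerivOn U (fun x => a x • f x) fun x => a x • g x + a' x • f x := by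
  intro φ hφ hc hs
  have hloc := hU.isLocallyClosed
  have i₁ := integrable_deriv_smul_of_tsupport_subset
    (LocallyIntegrableOn.continuousOn_smul hloc hf ha.continuousOn) hφ hc hs
  have i₂ := integrable_smul_of_tsupport_subset (LocallyIntegrableOn.continuousOn_smul hloc hf
    (continuousOn_of_hasDerivAt hU ha ha')) hφ.continuous hc hs
  have i₃ := integrable_smul_of_tsupport_subset
    (LocallyIntegrableOn.continuousOn_smul hloc hg ha.continuousOn) hφ.continuous hc hs
  have hderiv : deriv (fun x => φ x * a x) = fun x => φ x * a' x + deriv φ x * a x :=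
    funext fun x =>
      (hasDerivAt_smul_of_tsupport_subset (hφ.differentiable (by simp)) hs ha' x).deriv
  have key := h _ (contDiff_mul_of_tsupport_subset hU ha hφ hs) hc.mul_right
    ((tsupport_mul_subset_left (f := φ) (g := a)).trans hs)
  simp only [hderiv, add_smul, mul_smul] at key
  rw [integral_add i₂ i₁] at key
  simp only [smul_add]
  rw [integral_add i₃ i₂, neg_add, ← key]
  abel

end HasWeakDerivOn

theorem exists_primitive_of_integral_eq_zero {η : ℝ → ℝ} (hU : U.OrdConnected)
    (hη : ContDiff ℝ (⊤ : ℕ∞) η) (hc : HasCompactSupport η) (hs : tsupport η ⊆ U)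
    (h₀ : ∫ x, η x = 0) :
    ∃ φ : ℝ → ℝ, ContDiff ℝ (⊤ : ℕ∞) φ ∧ HasCompactSupport φ ∧ tsupport φ ⊆ U ∧ deriv φ = η := by
  rcases (tsupport η).eq_empty_or_nonempty with hemp | hne
  · refine ⟨0, contDiff_const, HasCompactSupport.zero, by simp [tsupport], ?_⟩
    rw [tsupport_eq_empty_iff.1 hemp, Pi.zero_def, deriv_const']
  obtain ⟨b, hb, hbmax⟩ := hc.isCompact.exists_isGreatest hne
  obtain ⟨c, hcη, hcmin⟩ := hc.isCompact.exists_isLeast hne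
  have hz : ∀ x ∉ Set.Icc c b, η x = 0 := fun x hx =>
    image_eq_zero_of_notMem_tsupport fun h => hx ⟨hcmin h, hbmax h⟩
  set φ : ℝ → ℝ := fun x => ∫ t in (c - 1)..x, η t
  have hderiv : ∀ x, HasDerivAt φ (η x) x := fun x =>
    intervalIntegral.integral_hasDerivAt_right (hη.continuous.intervalIntegrable _ _)
      (hη.continuous.stronglyMeasurableAtFilter _ _) hη.continuous.continuousAt
  have hφη : deriv φ = η := funext fun x => (hderiv x).deriv
  have hφ : Function.support φ ⊆ Set.Icc c b := by
    refine fun x hx => ⟨not_lt.1 fun hxc => hx ?_, not_lt.1 fun hbx => hx ?_⟩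
    · refine (intervalIntegral.integral_congr (g := fun _ => 0) fun t ht => ?_).trans (by simp)
      exact hz t fun h => (ht.2.trans_lt (max_lt (by linarith) hxc)).not_ge h.1
    · refine (intervalIntegral.integral_eq_integral_of_support_subset fun t ht => ?_).trans h₀
      have htcb := not_imp_comm.1 (hz t) ht
      exact ⟨by linarith [htcb.1], htcb.2.trans hbx.le⟩
  exact ⟨φ, contDiff_infty_iff_deriv.2 ⟨fun x => (hderiv x).differentiableAt, hφη ▸ hη⟩,
    .of_support_subset_isCompact isCompact_Icc hφ,
    (closure_minimal hφ isClosed_Icc).trans (hU.out (hs hcη) (hs hb)), hφη⟩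

theorem exists_bump (hU : IsOpen U) (hne : U.Nonempty) : ∃ ρ : ℝ → ℝ, ContDiff ℝ (⊤ : ℕ∞) ρ ∧
    HasCompactSupport ρ ∧ tsupport ρ ⊆ U ∧ ∫ x, ρ x = 1 := by
  obtain ⟨c, hc⟩ := hne
  obtain ⟨r, hr, hball⟩ := Metric.nhds_basis_closedBall.mem_iff.1 (hU.mem_nhds hc)
  let bump : ContDiffBump c := ⟨r / 2, r, half_pos hr, half_lt_self hr⟩
  exact ⟨bump.normed volume, bump.contDiff_normed, bump.hasCompactSupport_normed,
    bump.tsupport_normed_eq.trans_subset hball, bump.integral_normed⟩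

/-- The **du Bois-Reymond lemma**: test functions of integral zero are derivatives of test
functions. -/
theorem HasWeakDerivOn.exists_ae_eq_const [CompleteSpace E] (h : HasWeakDerivOn U f 0)
    (hU : IsOpen U) (hUc : U.OrdConnected) (hf : LocallyIntegrableOn f U) :
    ∃ c : E, ∀ᵐ x, x ∈ U → f x = c := by
  rcases U.eq_empty_or_nonempty with rfl | hne
  · exact ⟨0, by simp⟩
  obtain ⟨ρ, hρ, hρc, hρs, hρ₁⟩ := exists_bump hU hne
  have iρ := integrable_smul_of_tsupport_subset hf hρ.continuous hρc hρs
  have iρ' : Integrable ρ := hρ.continuous.integrable_of_hasCompactSupport hρc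
  set c : E := ∫ x, ρ x • f x with hc
  have hfc : LocallyIntegrableOn (fun x => f x - c) U :=
    hf.sub ((locallyIntegrable_const c).locallyIntegrableOn U)
  refine ⟨c, (hU.ae_eq_zero_of_integral_contDiff_smul_eq_zero hfc fun ψ hψ hψc hψs => ?_).mono
    fun x hx hxU => sub_eq_zero.1 (hx hxU)⟩
  have iψ := integrable_smul_of_tsupport_subset hf hψ.continuous hψc hψs
  have iψ' : Integrable ψ := hψ.continuous.integrable_of_hasCompactSupport hψc
  have hmean : ∫ x, (ψ x - (∫ y, ψ y) * ρ x) = 0 := by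
    rw [integral_sub iψ' (iρ'.const_mul _), integral_const_mul, hρ₁, mul_one, sub_self]
  obtain ⟨φ, hφ, hφc, hφs, hφη⟩ := exists_primitive_of_integral_eq_zero hUc
    (hψ.sub (contDiff_const.mul hρ)) (hψc.sub hρc.mul_left)
    ((tsupport_sub _ _).trans (Set.union_subset hψs (tsupport_mul_subset_right.trans hρs))) hmean
  have key := h φ hφ hφc hφs
  simp only [hφη, sub_smul, mul_smul, Pi.zero_apply, smul_zero, integral_zero, neg_zero] at key
  rw [integral_sub iψ (by exact iρ.smul (∫ y, ψ y)), integral_smul, ← hc] at key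
  simp only [smul_sub]
  rw [integral_sub iψ (iψ'.smul_const c), integral_smul_const, key]

end WeakDeriv

/-! ### Square integrable solutions on a half-line -/

theorem contDiff_of_hasDerivAt {p s s' : ℝ → ℝ} (hp : ContDiff ℝ (⊤ : ℕ∞) p)
    (hs : ∀ x, HasDerivAt s (s' x) x) (hs' : ∀ x, HasDerivAt s' (p x * s x) x) :
    ContDiff ℝ (⊤ : ℕ∞) s ∧ ContDiff ℝ (⊤ : ℕ∞) s' := by
  have hd : deriv s = s' := funext fun x => (hs x).deriv
  have hd' : deriv s' = fun x => p x * s x := funext fun x => (hs' x).deriv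
  have key (n : ℕ) : ContDiff ℝ n s ∧ ContDiff ℝ n s' := by
    induction n with
    | zero =>
      exact ⟨contDiff_zero.2 (continuous_iff_continuousAt.2 fun x => (hs x).continuousAt),
        contDiff_zero.2 (continuous_iff_continuousAt.2 fun x => (hs' x).continuousAt)⟩
    | succ n ih =>
      push_cast
      exact ⟨contDiff_succ_iff_deriv.2 ⟨fun x => (hs x).differentiableAt, by simp, hd ▸ ih.2⟩,
        contDiff_succ_iff_deriv.2 ⟨fun x => (hs' x).differentiableAt, by simp,
          hd' ▸ (hp.of_le (mod_cast le_top)).mul ih.1⟩⟩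
  exact ⟨contDiff_infty.2 fun n => (key n).1, contDiff_infty.2 fun n => (key n).2⟩

/-- `s`, with derivative `s'`, is a solution on `ℝ` of `s'' = p s` with smooth `p` which is square
integrable on `U` together with its derivative, and does not vanish on the closure of `U`. -/
structure IsL2SolutionOn (U : Set ℝ) (p s s' : ℝ → ℝ) : Prop where
  contDiff_coeff : ContDiff ℝ (⊤ : ℕ∞) p
  hasDerivAt : ∀ x, HasDerivAt s (s' x) x
  hasDerivAt' : ∀ x, HasDerivAt s' (p x * s x) x
  memLp : MemLp s 2 (volume.restrict U)
  memLp' : MemLp s' 2 (volume.restrict U)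
  ne_zero : ∀ x ∈ closure U, s x ≠ 0

namespace IsL2SolutionOn

variable {E : Type*} [NormedAddCommGroup E] [NormedSpace ℝ E] {U : Set ℝ} {p s s' : ℝ → ℝ}
  {f f₁ f₂ : ℝ → E}

theorem continuous (hs : IsL2SolutionOn U p s s') : Continuous s :=
  continuous_iff_continuousAt.2 fun x => (hs.hasDerivAt x).continuousAt

theorem continuous' (hs : IsL2SolutionOn U p s s') : Continuous s' :=
  continuous_iff_continuousAt.2 fun x => (hs.hasDerivAt' x).continuousAt

theorem hasWeakDerivOn_wronskian (hs : IsL2SolutionOn U p s s')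
    (hU : IsOpen U) (hf : LocallyIntegrableOn f U) (hf₁ : LocallyIntegrableOn f₁ U)
    (hf₂ : LocallyIntegrableOn f₂ U) (h₁ : HasWeakDerivOn U f f₁) (h₂ : HasWeakDerivOn U f₁ f₂)
    (heq : ∀ᵐ x, x ∈ U → f₂ x = p x • f x) :
    HasWeakDerivOn U (fun x => s x • f₁ x - s' x • f x) 0 := by
  obtain ⟨sm, sm'⟩ := contDiff_of_hasDerivAt hs.contDiff_coeff hs.hasDerivAt hs.hasDerivAt'
  have hloc {a : ℝ → ℝ} {g : ℝ → E} (ha : Continuous a) (hg : LocallyIntegrableOn g U) :=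
    LocallyIntegrableOn.continuousOn_smul hU.isLocallyClosed hg ha.continuousOn
  have c := hs.continuous
  have c' := hs.continuous'
  have c'' := hs.contDiff_coeff.continuous.mul c
  refine ((h₂.smul hU sm.contDiffOn (fun x _ => hs.hasDerivAt x) hf₁ hf₂).sub
    (h₁.smul hU sm'.contDiffOn (fun x _ => hs.hasDerivAt' x) hf hf₁) (hloc c hf₁) (hloc c' hf)
    ((hloc c hf₂).add (hloc c' hf₁)) ((hloc c' hf₁).add (hloc c'' hf))).congr_right ?_
  filter_upwards [heq] with x hx hxU
  rw [hx hxU, Pi.zero_apply, smul_smul, mul_comm (s x)]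
  abel

variable [CompleteSpace E]

/-- The Wronskian is constant, and integrable on a set of infinite measure. -/
theorem wronskian_ae_eq_zero (hs : IsL2SolutionOn U p s s')
    (hU : IsOpen U) (hUc : U.OrdConnected) (hUv : volume U = ∞)
    (hf : MemLp f 2 volume) (hf₁ : MemLp f₁ 2 volume) (hf₂ : MemLp f₂ 2 volume)
    (h₁ : HasWeakDerivOn U f f₁) (h₂ : HasWeakDerivOn U f₁ f₂)
    (heq : ∀ᵐ x, x ∈ U → f₂ x = p x • f x) :
    ∀ᵐ x, x ∈ U → s x • f₁ x = s' x • f x := by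
  have hl {g : ℝ → E} (hg : MemLp g 2 volume) : LocallyIntegrableOn g U :=
    (hg.locallyIntegrable one_le_two).locallyIntegrableOn U
  have hW := hs.hasWeakDerivOn_wronskian hU (hl hf) (hl hf₁) (hl hf₂) h₁ h₂ heq
  have hint : IntegrableOn (fun x => s x • f₁ x - s' x • f x) U :=
    (memLp_one_iff_integrable.1 ((hf₁.restrict U).smul hs.memLp)).sub
      (memLp_one_iff_integrable.1 ((hf.restrict U).smul hs.memLp'))
  obtain ⟨c, hc⟩ := hW.exists_ae_eq_const hU hUc hint.locallyIntegrableOn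
  have hcint : IntegrableOn (fun _ => c) U :=
    hint.congr ((ae_restrict_iff' hU.measurableSet).2 hc)
  obtain rfl : c = 0 := enorm_eq_zero.1 (((integrableOn_const_iff (by simp)).1 hcint).resolve_right
    (by simp [hUv]))
  exact hc.mono fun x hx hxU => sub_eq_zero.1 (hx hxU)

theorem exists_ae_eq_smul (hs : IsL2SolutionOn U p s s')
    (hU : IsOpen U) (hUc : U.OrdConnected) (hUv : volume U = ∞)
    (hf : MemLp f 2 volume) (hf₁ : MemLp f₁ 2 volume) (hf₂ : MemLp f₂ 2 volume)
    (h₁ : HasWeakDerivOn U f f₁) (h₂ : HasWeakDerivOn U f₁ f₂)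
    (heq : ∀ᵐ x, x ∈ U → f₂ x = p x • f x) :
    ∃ c : E, ∀ᵐ x, x ∈ U → f x = s x • c ∧ f₁ x = s' x • c := by
  have hW := hs.wronskian_ae_eq_zero hU hUc hUv hf hf₁ hf₂ h₁ h₂ heq
  have hl {g : ℝ → E} (hg : MemLp g 2 volume) : LocallyIntegrableOn g U :=
    (hg.locallyIntegrable one_le_two).locallyIntegrableOn U
  have hne (x : ℝ) (hx : x ∈ U) : s x ≠ 0 := hs.ne_zero x (subset_closure hx)
  have sm := (contDiff_of_hasDerivAt hs.contDiff_coeff hs.hasDerivAt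
    hs.hasDerivAt').1.contDiffOn.inv hne
  have hquot : HasWeakDerivOn U (fun x => (s x)⁻¹ • f x) 0 := by
    refine (h₁.smul hU sm (fun x hx => (hs.hasDerivAt x).inv (hne x hx)) (hl hf)
      (hl hf₁)).congr_right ?_
    filter_upwards [hW] with x hx hxU
    have hf₁x : f₁ x = (s x)⁻¹ • s' x • f x := by rw [← hx hxU, inv_smul_smul₀ (hne x hxU)]
    rw [hf₁x, smul_smul, smul_smul, ← add_smul, Pi.zero_apply, Pi.inv_apply]
    convert zero_smul ℝ (f x) using 2
    ring
  obtain ⟨c, hc⟩ := hquot.exists_ae_eq_const hU hUc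
    (LocallyIntegrableOn.continuousOn_smul hU.isLocallyClosed (hl hf) sm.continuousOn)
  refine ⟨c, ?_⟩
  filter_upwards [hc, hW] with x hx hWx hxU
  have hfx : f x = s x • c := by rw [← hx hxU, smul_inv_smul₀ (hne x hxU)]
  refine ⟨hfx, smul_right_injective E (hne x hxU) ?_⟩
  dsimp only
  rw [hWx hxU, hfx, smul_comm]

end IsL2SolutionOn

/-! ### The interface at the origin -/

section Glue

variable {f f' g g' : ℝ → ℝ} {x : ℝ}

/-- The function equal to `f` on the negative half-line and to `g` on `[0, ∞)`. -/
def glue (f g : ℝ → ℝ) : ℝ → ℝ := (Set.Iio 0).piecewise f g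

theorem glue_of_neg (f g : ℝ → ℝ) (hx : x < 0) : glue f g x = f x :=
  Set.piecewise_eq_of_mem _ _ _ hx

theorem glue_of_nonneg (f g : ℝ → ℝ) (hx : 0 ≤ x) : glue f g x = g x :=
  Set.piecewise_eq_of_notMem _ _ _ hx.not_gt

theorem glue_of_pos (f g : ℝ → ℝ) (hx : 0 < x) : glue f g x = g x :=
  glue_of_nonneg f g hx.le

theorem memLp_glue (hf : MemLp f 2 (volume.restrict (Set.Iio 0)))
    (hg : MemLp g 2 (volume.restrict (Set.Ioi 0))) : MemLp (glue f g) 2 volume :=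
  hf.piecewise measurableSet_Iio (by rwa [Set.compl_Iio, ← restrict_Ioi_eq_restrict_Ici])

theorem hasDerivAt_glue (hf : ∀ x, HasDerivAt f (f' x) x) (hg : ∀ x, HasDerivAt g (g' x) x)
    (hx : x ≠ 0) : HasDerivAt (glue f g) (glue f' g' x) x := by
  rcases hx.lt_or_gt with h | h
  · rw [glue_of_neg _ _ h]
    exact (hf x).congr_of_eventuallyEq
      ((eventually_lt_nhds h).mono fun y hy => glue_of_neg f g hy)
  · rw [glue_of_pos _ _ h]
    exact (hg x).congr_of_eventuallyEq
      ((eventually_gt_nhds h).mono fun y hy => glue_of_pos f g hy)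

end Glue

theorem isWeakDeriv_of_hasDerivAt {f g : L2} {F G : ℝ → ℂ} (hf : f =ᵐ[volume] F)
    (hg : g =ᵐ[volume] G) (hd : ∀ x ≠ 0, HasDerivAt F (G x) x) : IsWeakDeriv f g := by
  intro φ hφ hc hs
  have hG : LocallyIntegrable G := ((Lp.memLp g).ae_eq hg).locallyIntegrable one_le_two
  rw [integral_congr_ae (hf.mono fun x hx => congrArg (deriv φ x • ·) hx),
    integral_congr_ae (hg.mono fun x hx => congrArg (φ x • ·) hx)]
  exact HasWeakDerivOn.of_hasDerivAt isOpen_compl_singleton hd (hG.locallyIntegrableOn _) φ hφ hc hs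

theorem zero_mem_closure_Iio : (0 : ℝ) ∈ closure (Set.Iio 0) := by simp [closure_Iio]

section Trace

variable {U : Set ℝ} {x : ℝ}

theorem nhdsWithin_inf_ae_neBot (hU : IsOpen U) (hx : x ∈ closure U) :
    (𝓝[U] x ⊓ ae (volume : Measure ℝ)).NeBot := by
  refine inf_neBot_iff.2 fun s hs t ht => ?_
  obtain ⟨V, hV, hxV, hVs⟩ := mem_nhdsWithin.1 hs
  have hVU : 0 < volume (V ∩ U) :=
    (hV.inter hU).measure_pos volume (mem_closure_iff.1 hx V hV hxV)
  rw [← measure_inter_conull (mem_ae_iff.1 ht)] at hVU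
  obtain ⟨y, hy, hyt⟩ := nonempty_of_measure_ne_zero hVU.ne'
  exact ⟨y, hVs hy, hyt⟩

theorem tendsto_nhdsWithin_inf_ae {f g : ℝ → ℂ} (hg : ContinuousAt g x)
    (h : ∀ᵐ y, y ∈ U → f y = g y) : Tendsto f (𝓝[U] x ⊓ ae volume) (𝓝 (g x)) := by
  refine ((hg.mono_left nhdsWithin_le_nhds).mono_left inf_le_left).congr' ?_
  filter_upwards [h.filter_mono inf_le_right, eventually_mem_nhdsWithin.filter_mono inf_le_left]
    with y hy hyU using (hy hyU).symm

end Trace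

section Interface

variable {γ : ℝ} {p₁ s₁ s₁' p₂ s₂ s₂' : ℝ → ℝ}

/-- The matching condition at the interface: some nonzero combination of `s₁` on the negative and
`s₂` on the positive half-line satisfies the `δ'` boundary conditions of strength `γ`. -/
def IsMatched (γ : ℝ) (s₁ s₁' s₂ s₂' : ℝ → ℝ) : Prop :=
  s₁' 0 * (s₂ 0 + γ * s₂' 0) = s₁ 0 * s₂' 0

/-- The multiple of `s₁` to be joined to `s₂` at the origin for the jump condition
`u(0+) - u(0-) = -γ u'(0+)` to hold. -/
def interfaceRatio (γ : ℝ) (s₁ s₂ s₂' : ℝ → ℝ) : ℝ := (s₂ 0 + γ * s₂' 0) / s₁ 0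

/-- The candidate eigenfunction, equal to `s₂` on the positive half-line. -/
def interfaceFun (γ : ℝ) (s₁ s₂ s₂' : ℝ → ℝ) : ℝ → ℝ :=
  glue (fun x => s₁ x * interfaceRatio γ s₁ s₂ s₂') s₂

theorem deltaPrimeCondition_iff_of_ae_eq {u u' : L2} {c₁ c₂ : ℂ} (hs₁ : Continuous s₁)
    (hs₁' : Continuous s₁') (hs₂ : Continuous s₂) (hs₂' : Continuous s₂')
    (h₁ : ∀ᵐ x, x ∈ Set.Iio 0 → u x = s₁ x • c₁ ∧ u' x = s₁' x • c₁)
    (h₂ : ∀ᵐ x, x ∈ Set.Ioi 0 → u x = s₂ x • c₂ ∧ u' x = s₂' x • c₂) :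
    DeltaPrimeCondition γ u u' ↔
      s₁' 0 • c₁ = s₂' 0 • c₂ ∧ s₂ 0 • c₂ - s₁ 0 • c₁ = -(γ : ℂ) * s₂' 0 • c₂ := by
  have hr : HasRightTrace u (s₂ 0 • c₂) :=
    tendsto_nhdsWithin_inf_ae (hs₂.smul continuous_const).continuousAt
      (h₂.mono fun x hx hx₀ => (hx hx₀).1)
  have hr' : HasRightTrace u' (s₂' 0 • c₂) :=
    tendsto_nhdsWithin_inf_ae (hs₂'.smul continuous_const).continuousAt
      (h₂.mono fun x hx hx₀ => (hx hx₀).2)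
  have hl : HasLeftTrace u (s₁ 0 • c₁) :=
    tendsto_nhdsWithin_inf_ae (hs₁.smul continuous_const).continuousAt
      (h₁.mono fun x hx hx₀ => (hx hx₀).1)
  have hl' : HasLeftTrace u' (s₁' 0 • c₁) :=
    tendsto_nhdsWithin_inf_ae (hs₁'.smul continuous_const).continuousAt
      (h₁.mono fun x hx hx₀ => (hx hx₀).2)
  have : (𝓝[>] (0 : ℝ) ⊓ ae volume).NeBot :=
    nhdsWithin_inf_ae_neBot isOpen_Ioi (by simp [closure_Ioi])
  have : (𝓝[<] (0 : ℝ) ⊓ ae volume).NeBot :=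
    nhdsWithin_inf_ae_neBot isOpen_Iio zero_mem_closure_Iio
  constructor
  · rintro ⟨a, b, d, ha, hb, hd, hd', hab⟩
    rw [tendsto_nhds_unique hr ha, tendsto_nhds_unique hl hb, tendsto_nhds_unique hr' hd]
    exact ⟨tendsto_nhds_unique hl' hd', hab⟩
  · rintro ⟨hd, hab⟩
    exact ⟨_, _, _, hr, hl, hr', hd ▸ hl', hab⟩

theorem transmission_conditions_iff {c₁ c₂ : ℂ} (h₀ : s₁ 0 ≠ 0) :
    (s₁' 0 • c₁ = s₂' 0 • c₂ ∧ s₂ 0 • c₂ - s₁ 0 • c₁ = -(γ : ℂ) * s₂' 0 • c₂) ↔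
      c₁ = interfaceRatio γ s₁ s₂ s₂' • c₂ ∧ (IsMatched γ s₁ s₁' s₂ s₂' ∨ c₂ = 0) := by
  have h₀' : (s₁ 0 : ℂ) ≠ 0 := Complex.ofReal_ne_zero.2 h₀
  have hjump : s₂ 0 • c₂ - s₁ 0 • c₁ = -(γ : ℂ) * s₂' 0 • c₂ ↔
      c₁ = interfaceRatio γ s₁ s₂ s₂' • c₂ := by
    simp only [interfaceRatio, Complex.real_smul]
    push_cast
    rw [div_mul_eq_mul_div, eq_div_iff h₀']
    constructor <;> intro h <;> linear_combination -h
  rw [and_comm, hjump]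
  refine and_congr_right ?_
  rintro rfl
  rw [smul_smul, ← sub_eq_zero, ← sub_smul, smul_eq_zero, sub_eq_zero, IsMatched, interfaceRatio,
    mul_div_assoc', div_eq_iff h₀, mul_comm (s₂' 0)]

theorem interfaceFun_of_neg {x : ℝ} (hx : x < 0) :
    interfaceFun γ s₁ s₂ s₂' x = s₁ x * interfaceRatio γ s₁ s₂ s₂' := glue_of_neg _ _ hx

theorem interfaceFun_of_pos {x : ℝ} (hx : 0 < x) : interfaceFun γ s₁ s₂ s₂' x = s₂ x :=
  glue_of_pos _ _ hx

end Interface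

/-! ### Eigenspaces of the linearized operator -/

section Eigenspace

variable {γ ω μ lam ν : ℝ} {ψ : ℝ → ℂ} {p₁ s₁ s₁' p₂ s₂ s₂' : ℝ → ℝ}

theorem linearizedL1_toFun_ae_eq (hψ : MemLp (linearizedPotential μ lam ψ) ∞ volume)
    (u : (linearizedL1 γ ω μ lam ψ hψ).domain) {u' u'' : L2} (h : IsH2With (u : L2) u' u'') :
    (linearizedL1 γ ω μ lam ψ hψ).toFun u =ᵐ[volume]
      fun x => -u'' x + ω * (u : L2) x - linearizedPotential μ lam ψ x * (u : L2) x := by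
  have hu : (linearizedL1 γ ω μ lam ψ hψ).toFun u = -u'' + (ω : ℂ) • (u : L2)
      - (hψ.toLp (linearizedPotential μ lam ψ) • (u : L2) : L2) := by
    rw [← secondDeriv_eq (γ := γ) (u := u) h]
    rfl
  rw [hu]
  filter_upwards [Lp.coeFn_sub (-u'' + (ω : ℂ) • (u : L2))
      (hψ.toLp (linearizedPotential μ lam ψ) • (u : L2) : L2),
    Lp.coeFn_add (-u'') ((ω : ℂ) • (u : L2)), Lp.coeFn_neg u'', Lp.coeFn_smul (ω : ℂ) (u : L2),
    Lp.coeFn_lpSMul (r := 2) (hψ.toLp (linearizedPotential μ lam ψ)) (u : L2),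
    hψ.coeFn_toLp] with x hsub hadd hneg hsmul hmul hV
  rw [hsub, Pi.sub_apply, hadd, Pi.add_apply, hneg, Pi.neg_apply, hsmul, hmul, Pi.smul_apply,
    Pi.smul_apply', hV, smul_eq_mul, smul_eq_mul]

theorem mem_eigenspaceOf_linearizedL1 (hψ : MemLp (linearizedPotential μ lam ψ) ∞ volume)
    (u : (linearizedL1 γ ω μ lam ψ hψ).domain) {u' u'' : L2} (h : IsH2With (u : L2) u' u'') :
    u ∈ eigenspaceOf (linearizedL1 γ ω μ lam ψ hψ) ν ↔
      ∀ᵐ x, u'' x = ((ω - ν : ℝ) - linearizedPotential μ lam ψ x) * (u : L2) x := by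
  have hker : u ∈ eigenspaceOf (linearizedL1 γ ω μ lam ψ hψ) ν ↔
      (linearizedL1 γ ω μ lam ψ hψ).toFun u = (ν : ℂ) • (u : L2) := by
    rw [eigenspaceOf, LinearMap.mem_ker, LinearMap.sub_apply, sub_eq_zero]
    rfl
  rw [hker, Lp.ext_iff]
  refine eventually_congr ?_
  filter_upwards [linearizedL1_toFun_ae_eq hψ u h, Lp.coeFn_smul (ν : ℂ) (u : L2)] with x hL hν
  rw [hL, hν, Pi.smul_apply, smul_eq_mul]
  push_cast
  constructor <;> intro hx <;> linear_combination -hx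

theorem ae_ne_zero : ∀ᵐ x : ℝ, x ≠ 0 := by
  simp [ae_iff]

theorem exists_smul_interfaceFun_of_mem_eigenspaceOf (hs₁ : IsL2SolutionOn (Set.Iio 0) p₁ s₁ s₁')
    (hs₂ : IsL2SolutionOn (Set.Ioi 0) p₂ s₂ s₂')
    (hψ : MemLp (linearizedPotential μ lam ψ) ∞ volume)
    (hV : ∀ x, ((ω - ν : ℝ) : ℂ) - linearizedPotential μ lam ψ x = glue p₁ p₂ x)
    {u : (linearizedL1 γ ω μ lam ψ hψ).domain}
    (hu : u ∈ eigenspaceOf (linearizedL1 γ ω μ lam ψ hψ) ν) :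
    ∃ c : ℂ, (∀ᵐ x, (u : L2) x = interfaceFun γ s₁ s₂ s₂' x • c) ∧
      (IsMatched γ s₁ s₁' s₂ s₂' ∨ c = 0) := by
  obtain ⟨u', u'', hH2, hδ⟩ := u.2
  have heq := (mem_eigenspaceOf_linearizedL1 hψ u hH2).1 hu
  obtain ⟨c₁, hc₁⟩ := hs₁.exists_ae_eq_smul isOpen_Iio Set.ordConnected_Iio Real.volume_Iio
    (Lp.memLp (u : L2)) (Lp.memLp u') (Lp.memLp u'')
    (hH2.first.hasWeakDerivOn Set.self_notMem_Iio)
    (hH2.second.hasWeakDerivOn Set.self_notMem_Iio) (by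
      filter_upwards [heq] with x hx hx₀
      rw [hx, hV, glue_of_neg _ _ hx₀, Complex.real_smul])
  obtain ⟨c, hc⟩ := hs₂.exists_ae_eq_smul isOpen_Ioi Set.ordConnected_Ioi Real.volume_Ioi
    (Lp.memLp (u : L2)) (Lp.memLp u') (Lp.memLp u'')
    (hH2.first.hasWeakDerivOn Set.self_notMem_Ioi)
    (hH2.second.hasWeakDerivOn Set.self_notMem_Ioi) (by
      filter_upwards [heq] with x hx hx₀
      rw [hx, hV, glue_of_pos _ _ hx₀, Complex.real_smul])
  have hs₁₀ : s₁ 0 ≠ 0 := hs₁.ne_zero 0 zero_mem_closure_Iio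
  obtain ⟨rfl, hmatch⟩ := (transmission_conditions_iff hs₁₀).1
    ((deltaPrimeCondition_iff_of_ae_eq hs₁.continuous hs₁.continuous' hs₂.continuous
      hs₂.continuous' hc₁ hc).1 hδ)
  refine ⟨c, ?_, hmatch⟩
  filter_upwards [hc₁, hc, ae_ne_zero] with x hx₁ hx₂ hx
  rcases hx.lt_or_gt with h | h
  · rw [(hx₁ h).1, interfaceFun_of_neg h, smul_smul]
  · rw [(hx₂ h).1, interfaceFun_of_pos h]

theorem memLp_interfaceFun (hs₁ : IsL2SolutionOn (Set.Iio 0) p₁ s₁ s₁')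
    (hs₂ : IsL2SolutionOn (Set.Ioi 0) p₂ s₂ s₂') :
    MemLp (fun x => (interfaceFun γ s₁ s₂ s₂' x : ℂ)) 2 volume :=
  (memLp_glue (hs₁.memLp.mul_const _) hs₂.memLp).ofReal

theorem exists_isH2With_interfaceFun (hs₁ : IsL2SolutionOn (Set.Iio 0) p₁ s₁ s₁')
    (hs₂ : IsL2SolutionOn (Set.Ioi 0) p₂ s₂ s₂') (hmatch : IsMatched γ s₁ s₁' s₂ s₂')
    {u u'' : L2} (hu : ∀ᵐ x, u x = interfaceFun γ s₁ s₂ s₂' x)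
    (hu'' : ∀ᵐ x, u'' x = glue p₁ p₂ x * u x) :
    ∃ u' : L2, IsH2With u u' u'' ∧ DeltaPrimeCondition γ u u' := by
  set α := interfaceRatio γ s₁ s₂ s₂'
  have hm' : MemLp (fun x => (glue (fun x => s₁' x * α) s₂' x : ℂ)) 2 volume :=
    (memLp_glue (hs₁.memLp'.mul_const α) hs₂.memLp').ofReal
  have hsecond : ∀ᵐ x, u'' x = glue (fun x => p₁ x * s₁ x * α) (fun x => p₂ x * s₂ x) x := by
    filter_upwards [hu, hu'', ae_ne_zero] with x hx hx'' hx₀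
    rw [hx'', hx, ← Complex.ofReal_mul]
    rcases hx₀.lt_or_gt with h | h
    · rw [interfaceFun_of_neg h, glue_of_neg _ _ h, glue_of_neg _ _ h, mul_assoc]
    · rw [interfaceFun_of_pos h, glue_of_pos _ _ h, glue_of_pos _ _ h]
  refine ⟨hm'.toLp _, ⟨isWeakDeriv_of_hasDerivAt hu hm'.coeFn_toLp fun x hx =>
      (hasDerivAt_glue (fun x => (hs₁.hasDerivAt x).mul_const α) hs₂.hasDerivAt hx).ofReal_comp,
    isWeakDeriv_of_hasDerivAt hm'.coeFn_toLp hsecond fun x hx =>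
      (hasDerivAt_glue (fun x => (hs₁.hasDerivAt' x).mul_const α) hs₂.hasDerivAt'
        hx).ofReal_comp⟩, ?_⟩
  have hleft : ∀ᵐ x, x ∈ Set.Iio 0 →
      u x = s₁ x • (α • 1 : ℂ) ∧ hm'.toLp _ x = s₁' x • (α • 1 : ℂ) := by
    filter_upwards [hu, hm'.coeFn_toLp] with x hx hx' h
    rw [hx, hx', interfaceFun_of_neg h, glue_of_neg _ _ h]
    simp [α]
  have hright : ∀ᵐ x, x ∈ Set.Ioi 0 →
      u x = s₂ x • (1 : ℂ) ∧ hm'.toLp _ x = s₂' x • (1 : ℂ) := by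
    filter_upwards [hu, hm'.coeFn_toLp] with x hx hx' h
    rw [hx, hx', interfaceFun_of_pos h, glue_of_pos _ _ h]
    simp
  exact (deltaPrimeCondition_iff_of_ae_eq hs₁.continuous hs₁.continuous' hs₂.continuous
    hs₂.continuous' hleft hright).2
    ((transmission_conditions_iff (hs₁.ne_zero 0 zero_mem_closure_Iio)).2 ⟨rfl, .inl hmatch⟩)

theorem exists_mem_eigenspaceOf_ae_eq_interfaceFun
    (hs₁ : IsL2SolutionOn (Set.Iio 0) p₁ s₁ s₁') (hs₂ : IsL2SolutionOn (Set.Ioi 0) p₂ s₂ s₂')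
    (hψ : MemLp (linearizedPotential μ lam ψ) ∞ volume)
    (hV : ∀ x, ((ω - ν : ℝ) : ℂ) - linearizedPotential μ lam ψ x = glue p₁ p₂ x)
    (hmatch : IsMatched γ s₁ s₁' s₂ s₂') :
    ∃ u : (linearizedL1 γ ω μ lam ψ hψ).domain,
      u ∈ eigenspaceOf (linearizedL1 γ ω μ lam ψ hψ) ν ∧
        ∀ᵐ x, (u : L2) x = interfaceFun γ s₁ s₂ s₂' x := by
  set u : L2 := (memLp_interfaceFun (γ := γ) hs₁ hs₂).toLp _
  have hu : ∀ᵐ x, u x = interfaceFun γ s₁ s₂ s₂' x := MemLp.coeFn_toLp _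
  set u'' : L2 := ((ω - ν : ℝ) : ℂ) • u - (hψ.toLp (linearizedPotential μ lam ψ) • u : L2)
  have hu'' : ∀ᵐ x, u'' x = ((ω - ν : ℝ) - linearizedPotential μ lam ψ x) * u x := by
    filter_upwards [Lp.coeFn_sub (((ω - ν : ℝ) : ℂ) • u)
        (hψ.toLp (linearizedPotential μ lam ψ) • u : L2), Lp.coeFn_smul ((ω - ν : ℝ) : ℂ) u,
      Lp.coeFn_lpSMul (r := 2) (hψ.toLp (linearizedPotential μ lam ψ)) u,
      hψ.coeFn_toLp] with x hsub hsmul hmul hV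
    rw [hsub, Pi.sub_apply, hsmul, hmul, Pi.smul_apply, Pi.smul_apply', hV, smul_eq_mul,
      smul_eq_mul, sub_mul]
  obtain ⟨u', hH2, hδ⟩ := exists_isH2With_interfaceFun (u'' := u'') hs₁ hs₂ hmatch hu
    (by simpa only [hV] using hu'')
  exact ⟨⟨u, u', u'', hH2, hδ⟩, (mem_eigenspaceOf_linearizedL1 hψ _ hH2).2 hu'', hu⟩

theorem eigenspaceOf_linearizedL1_eq_bot (hs₁ : IsL2SolutionOn (Set.Iio 0) p₁ s₁ s₁')
    (hs₂ : IsL2SolutionOn (Set.Ioi 0) p₂ s₂ s₂')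
    (hψ : MemLp (linearizedPotential μ lam ψ) ∞ volume)
    (hV : ∀ x, ((ω - ν : ℝ) : ℂ) - linearizedPotential μ lam ψ x = glue p₁ p₂ x)
    (hmatch : ¬IsMatched γ s₁ s₁' s₂ s₂') :
    eigenspaceOf (linearizedL1 γ ω μ lam ψ hψ) ν = ⊥ := by
  refine (Submodule.eq_bot_iff _).2 fun u hu => Subtype.ext (Lp.ext ?_)
  obtain ⟨c, hc, h | rfl⟩ := exists_smul_interfaceFun_of_mem_eigenspaceOf hs₁ hs₂ hψ hV hu
  · exact absurd h hmatch
  · filter_upwards [hc, Lp.coeFn_zero ℂ 2 (volume : Measure ℝ)] with x hx h₀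
    rw [hx, smul_zero]
    exact h₀.symm

theorem finrank_eigenspaceOf_linearizedL1 (hs₁ : IsL2SolutionOn (Set.Iio 0) p₁ s₁ s₁')
    (hs₂ : IsL2SolutionOn (Set.Ioi 0) p₂ s₂ s₂')
    (hψ : MemLp (linearizedPotential μ lam ψ) ∞ volume)
    (hV : ∀ x, ((ω - ν : ℝ) : ℂ) - linearizedPotential μ lam ψ x = glue p₁ p₂ x)
    (hmatch : IsMatched γ s₁ s₁' s₂ s₂') :
    Module.finrank ℂ (eigenspaceOf (linearizedL1 γ ω μ lam ψ hψ) ν) = 1 := by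
  obtain ⟨v, hv, hve⟩ := exists_mem_eigenspaceOf_ae_eq_interfaceFun hs₁ hs₂ hψ hV hmatch
  have hv₀ : (v : L2) ≠ 0 := fun h => by
    have hpos : ∀ᵐ x : ℝ, x ∉ Set.Ioi 0 := by
      filter_upwards [hve, (h ▸ Lp.coeFn_zero ℂ 2 volume : (v : L2) =ᵐ[volume] 0)] with x hx hx₀ hxp
      rw [hx₀, Pi.zero_apply, interfaceFun_of_pos hxp, eq_comm, Complex.ofReal_eq_zero] at hx
      exact hs₂.ne_zero x (subset_closure hxp) hx
    simpa using measure_eq_zero_iff_ae_notMem.2 hpos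
  refine (finrank_eq_one_iff_of_nonzero' ⟨v, hv⟩ fun h => hv₀ ?_).2 fun ⟨u, hu⟩ => ?_
  · exact congrArg Subtype.val (congrArg Subtype.val h)
  · obtain ⟨c, hc, -⟩ := exists_smul_interfaceFun_of_mem_eigenspaceOf hs₁ hs₂ hψ hV hu
    refine ⟨c, Subtype.ext (Subtype.ext (Lp.ext ?_))⟩
    filter_upwards [hc, hve, Lp.coeFn_smul c (v : L2)] with x hx hvx hcv
    exact hcv.trans (by rw [Pi.smul_apply, hvx, hx, Complex.real_smul, smul_eq_mul, mul_comm])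

end Eigenspace

/-! ### Matching the Jost solutions at the origin -/

section JostL2

variable {q f f' p s s' : ℝ → ℝ} {m k z l : ℝ} {U : Set ℝ}

theorem memLp_comp_affine (hm : 0 < m) (hk : 0 < k) (hf : Continuous f)
    (hlim : Tendsto (fun z => Real.exp (m * z) * f z) atTop (𝓝 l)) :
    MemLp (fun x => f (k * x + z)) 2 (volume.restrict (Set.Ioi 0)) := by
  have hc : Continuous fun x => f (k * x + z) := hf.comp (by fun_prop)
  rw [memLp_two_iff_integrable_sq hc.aestronglyMeasurable]
  refine integrable_of_isBigO_exp_neg (b := 2 * (m * k)) (by positivity) (hc.pow 2).continuousOn ?_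
  have haff : Tendsto (fun x : ℝ => k * x + z) atTop atTop :=
    tendsto_atTop_add_const_right _ _ (tendsto_id.const_mul_atTop hk)
  refine Asymptotics.isBigO_of_div_tendsto_nhds (.of_forall fun x hx =>
    absurd hx (Real.exp_pos _).ne') _
    ((((hlim.comp haff).pow 2).mul_const (Real.exp (-(2 * (m * z))))).congr fun x => ?_)
  have hexp : Real.exp ((2 : ℕ) * (m * (k * x + z))) * Real.exp (-(2 * (m * z))) *
      Real.exp (-(2 * (m * k)) * x) = 1 := by
    rw [← Real.exp_add, ← Real.exp_add, Real.exp_eq_one_iff]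
    push_cast
    ring
  simp only [Function.comp_apply, Pi.div_apply]
  rw [eq_div_iff (Real.exp_pos _).ne', mul_pow, ← Real.exp_nat_mul]
  linear_combination f (k * x + z) ^ 2 * hexp

theorem IsJost.isL2SolutionOn_comp_affine (hf : IsJost q m f f') (hm : 0 < m) (hk : 0 < k)
    (hq : ContDiff ℝ (⊤ : ℕ∞) q) (hne : ∀ y, z ≤ y → f y ≠ 0) :
    IsL2SolutionOn (Set.Ioi 0) (fun x => k ^ 2 * q (k * x + z)) (fun x => f (k * x + z))
      fun x => k * f' (k * x + z) := by
  have haff (x : ℝ) : HasDerivAt (fun x => k * x + z) k x := by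
    simpa using ((hasDerivAt_id x).const_mul k).add_const z
  refine ⟨contDiff_const.mul (hq.comp (by fun_prop)), fun x => ?_, fun x => ?_,
    memLp_comp_affine hm hk hf.continuous hf.tendsto,
    (memLp_comp_affine hm hk hf.continuous' hf.tendsto').const_mul k, fun x hx => ?_⟩
  · exact ((hf.hasDerivAt _).comp x (haff x)).congr_deriv (mul_comm _ _)
  · exact (((hf.hasDerivAt' _).comp x (haff x)).const_mul k).congr_deriv (by ring)
  · rw [closure_Ioi] at hx
    exact hne _ (le_add_of_nonneg_left (mul_nonneg hk.le hx))

theorem IsL2SolutionOn.comp_neg (hs : IsL2SolutionOn U p s s') (hU : MeasurableSet U) :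
    IsL2SolutionOn (Neg.neg ⁻¹' U) (fun x => p (-x)) (fun x => s (-x)) fun x => -s' (-x) := by
  have hneg := (Measure.measurePreserving_neg (volume : Measure ℝ)).restrict_preimage hU
  refine ⟨hs.contDiff_coeff.comp contDiff_neg, fun x => ?_, fun x => ?_,
    hs.memLp.comp_measurePreserving hneg, (hs.memLp'.comp_measurePreserving hneg).neg,
    fun x hx => hs.ne_zero _ (map_mem_closure continuous_neg hx fun _ hy => hy)⟩
  · exact ((hs.hasDerivAt (-x)).comp x (hasDerivAt_neg x)).congr_deriv (mul_neg_one _)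
  · exact ((hs.hasDerivAt' (-x)).comp x (hasDerivAt_neg x)).neg.congr_deriv (by ring)

end JostL2

section AsymmetricState

variable {γ ω μ lam t t₁ t₂ θ m m₀ k z z₁ z₂ : ℝ}

theorem contDiff_poschlTeller (Λ m : ℝ) : ContDiff ℝ (⊤ : ℕ∞) (poschlTeller Λ m) :=
  contDiff_const.sub (contDiff_const.div (Real.contDiff_cosh.pow 2)
    fun z => (pow_pos (Real.cosh_pos z) 2).ne')

theorem isL2SolutionOn_Ioi_jost (hm₀ : 0 < m₀) (hm : m₀ ≤ m) (hk : 0 < k) (hz : 0 < z) :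
    IsL2SolutionOn (Set.Ioi 0) (fun x => k ^ 2 * poschlTeller (ptCoupling m₀) m (k * x + z))
      (fun x => jost (ptCoupling m₀) m (k * x + z))
      fun x => k * jost' (ptCoupling m₀) m (k * x + z) :=
  (isJost_jost (ptCoupling_nonneg hm₀.le) (hm₀.le.trans hm)).isL2SolutionOn_comp_affine
    (hm₀.trans_le hm) hk (contDiff_poschlTeller _ _)
    fun _ hy => (jost_pos hm₀ hm (hz.trans_le hy)).ne'

theorem isL2SolutionOn_Iio_jost (hm₀ : 0 < m₀) (hm : m₀ ≤ m) (hk : 0 < k) (hz : 0 < z) :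
    IsL2SolutionOn (Set.Iio 0) (fun x => k ^ 2 * poschlTeller (ptCoupling m₀) m (k * -x + z))
      (fun x => jost (ptCoupling m₀) m (k * -x + z))
      fun x => -(k * jost' (ptCoupling m₀) m (k * -x + z)) := by
  have h := (isL2SolutionOn_Ioi_jost hm₀ hm hk hz).comp_neg measurableSet_Ioi
  rwa [Set.neg_preimage, Set.neg_Ioi, neg_zero] at h

theorem isMatched_jost_iff (hm₀ : 0 < m₀) (hm : m₀ ≤ m) (hk : 0 < k) (hz₁ : 0 < z₁)
    (hz₂ : 0 < z₂) :
    IsMatched γ (fun x => jost (ptCoupling m₀) m (k * -x + z₁))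
        (fun x => -(k * jost' (ptCoupling m₀) m (k * -x + z₁)))
        (fun x => jost (ptCoupling m₀) m (k * x + z₂))
        (fun x => k * jost' (ptCoupling m₀) m (k * x + z₂)) ↔
      matchDet (γ * k) (jostSlope (ptCoupling m₀) m z₁) (jostSlope (ptCoupling m₀) m z₂) = 0 := by
  have h₁ := (jost_pos hm₀ hm hz₁).ne'
  have h₂ := (jost_pos hm₀ hm hz₂).ne'
  simp only [IsMatched, matchDet, jostSlope, neg_zero, mul_zero, zero_add]
  field_simp
  constructor <;> intro h <;> linear_combination -h

theorem mul_centre (hω : 0 < ω) (hμ : 0 < μ) (ht : t ∈ Set.Ioo 0 1) :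
    μ * √ω * centre ω μ t = Real.artanh t := by
  have hpos : 0 < (1 + t) / (1 - t) := div_pos (by linarith [ht.1]) (sub_pos.2 ht.2)
  have := Real.sqrt_pos.2 hω
  rw [Real.artanh_eq_half_log ⟨by linarith [ht.1], ht.2.le⟩, centre, abs_of_pos hpos]
  field

theorem sub_linearizedPotential_asymmetricState (hω : 0 < ω) (hμ : 0 < μ) (hlam : 0 < lam)
    (ht₁ : t₁ ∈ Set.Ioo 0 1) (ht₂ : t₂ ∈ Set.Ioo 0 1) (m θ x : ℝ) :
    ((ω - (ω - (μ * √ω) ^ 2 * m ^ 2) : ℝ) : ℂ) -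
        linearizedPotential μ lam (asymmetricState ω μ lam t₁ t₂ θ) x =
      glue (fun x => (μ * √ω) ^ 2 *
          poschlTeller (ptCoupling (1 / μ)) m (μ * √ω * -x + Real.artanh t₁))
        (fun x => (μ * √ω) ^ 2 *
          poschlTeller (ptCoupling (1 / μ)) m (μ * √ω * x + Real.artanh t₂)) x := by
  have hcoupling : (μ * √ω) ^ 2 * ptCoupling (1 / μ) = ω * (μ + 1) * (2 * μ + 1) := by
    rw [mul_pow, Real.sq_sqrt hω.le, ptCoupling]
    field
  rw [linearizedPotential_asymmetricState hω hμ hlam, ← Complex.ofReal_sub, ← hcoupling]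
  congr 1
  simp only [poschlTeller]
  rcases lt_or_ge x 0 with hx | hx
  · rw [glue_of_neg _ _ hx, if_pos hx, ← mul_centre hω hμ ht₁,
      ← Real.cosh_neg (μ * √ω * (x + -centre ω μ t₁))]
    ring_nf
  · rw [glue_of_nonneg _ _ hx, if_neg hx.not_gt, ← mul_centre hω hμ ht₂]
    ring_nf

/-- The determinant whose zeros `m` give the eigenvalues `ω - μ² ω m²` of `L₁` below the
essential spectrum. -/
def asymmetricDet (γ ω μ t₁ t₂ m : ℝ) : ℝ :=
  matchDet (γ * (μ * √ω)) (jostSlope (ptCoupling (1 / μ)) m (Real.artanh t₁))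
    (jostSlope (ptCoupling (1 / μ)) m (Real.artanh t₂))

theorem eigenspaceOf_eq_bot_of_asymmetricDet_ne_zero (hω : 0 < ω) (hμ : 0 < μ) (hlam : 0 < lam)
    (ht₁ : t₁ ∈ Set.Ioo 0 1) (ht₂ : t₂ ∈ Set.Ioo 0 1) (hm : 1 / μ ≤ m)
    (hdet : asymmetricDet γ ω μ t₁ t₂ m ≠ 0) :
    eigenspaceOf (linearizedL1 γ ω μ lam (asymmetricState ω μ lam t₁ t₂ θ)
      (memLp_linearizedPotential hμ ω lam t₁ t₂ θ)) (ω - (μ * √ω) ^ 2 * m ^ 2 : ℝ) = ⊥ := by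
  have hk : 0 < μ * √ω := mul_pos hμ (Real.sqrt_pos.2 hω)
  have hz₁ := Real.artanh_pos ht₁
  have hz₂ := Real.artanh_pos ht₂
  have hμ' := one_div_pos.2 hμ
  exact eigenspaceOf_linearizedL1_eq_bot (isL2SolutionOn_Iio_jost hμ' hm hk hz₁)
    (isL2SolutionOn_Ioi_jost hμ' hm hk hz₂) _
    (sub_linearizedPotential_asymmetricState hω hμ hlam ht₁ ht₂ m θ)
    (mt (isMatched_jost_iff hμ' hm hk hz₁ hz₂).1 hdet)

theorem finrank_eigenspaceOf_of_asymmetricDet_eq_zero (hω : 0 < ω) (hμ : 0 < μ) (hlam : 0 < lam)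
    (ht₁ : t₁ ∈ Set.Ioo 0 1) (ht₂ : t₂ ∈ Set.Ioo 0 1) (hm : 1 / μ ≤ m)
    (hdet : asymmetricDet γ ω μ t₁ t₂ m = 0) :
    Module.finrank ℂ (eigenspaceOf (linearizedL1 γ ω μ lam (asymmetricState ω μ lam t₁ t₂ θ)
      (memLp_linearizedPotential hμ ω lam t₁ t₂ θ)) (ω - (μ * √ω) ^ 2 * m ^ 2 : ℝ)) = 1 := by
  have hk : 0 < μ * √ω := mul_pos hμ (Real.sqrt_pos.2 hω)
  have hz₁ := Real.artanh_pos ht₁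
  have hz₂ := Real.artanh_pos ht₂
  have hμ' := one_div_pos.2 hμ
  exact finrank_eigenspaceOf_linearizedL1 (isL2SolutionOn_Iio_jost hμ' hm hk hz₁)
    (isL2SolutionOn_Ioi_jost hμ' hm hk hz₂) _
    (sub_linearizedPotential_asymmetricState hω hμ hlam ht₁ ht₂ m θ)
    ((isMatched_jost_iff hμ' hm hk hz₁ hz₂).2 hdet)

theorem jostSlope_artanh (hμ : 0 < μ) (ht : t ∈ Set.Ioo 0 1) :
    jostSlope (ptCoupling (1 / μ)) (1 / μ) (Real.artanh t) =
      ((μ + 1) * t ^ 2 - μ) / (μ * t) := by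
  have := ht.1
  rw [jostSlope_self (one_div_pos.2 hμ) (Real.artanh_pos ht),
    Real.tanh_artanh ⟨by linarith, ht.2⟩]
  field

namespace IsAsymmetricSolution

theorem mem_Ioo₁ (h : IsAsymmetricSolution γ ω μ t₁ t₂) (hμ : 0 < μ) : t₁ ∈ Set.Ioo 0 1 :=
  ⟨h.1, h.lt_one₁ hμ⟩

theorem mem_Ioo₂ (h : IsAsymmetricSolution γ ω μ t₁ t₂) (hμ : 0 < μ) : t₂ ∈ Set.Ioo 0 1 :=
  ⟨h.pos₂, h.lt_one₂ hμ⟩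

theorem jostSlope_neg (h : IsAsymmetricSolution γ ω μ t₁ t₂) (hμ : 0 < μ) :
    jostSlope (ptCoupling (1 / μ)) (1 / μ) (Real.artanh t₁) < 0 := by
  rw [jostSlope_artanh hμ (h.mem_Ioo₁ hμ)]
  exact div_neg_of_neg_of_pos (sub_neg.2 (h.mul_sq_lt hμ)) (mul_pos hμ h.1)

theorem jostSlope_pos (h : IsAsymmetricSolution γ ω μ t₁ t₂) (hμ : 0 < μ) :
    0 < jostSlope (ptCoupling (1 / μ)) (1 / μ) (Real.artanh t₂) := by
  rw [jostSlope_artanh hμ (h.mem_Ioo₂ hμ)]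
  exact div_pos (sub_pos.2 (h.lt_mul_sq hμ)) (mul_pos hμ h.pos₂)

theorem inv_jostSlope_add_inv_jostSlope_lt (h : IsAsymmetricSolution γ ω μ t₁ t₂) (hγ : 0 < γ)
    (hμ : 0 < μ) (hω : 0 ≤ ω) :
    (jostSlope (ptCoupling (1 / μ)) (1 / μ) (Real.artanh t₁))⁻¹ +
      (jostSlope (ptCoupling (1 / μ)) (1 / μ) (Real.artanh t₂))⁻¹ < γ * (μ * √ω) := by
  rw [jostSlope_artanh hμ (h.mem_Ioo₁ hμ), jostSlope_artanh hμ (h.mem_Ioo₂ hμ), inv_div, inv_div,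
    mul_div_assoc, mul_div_assoc, ← mul_add, mul_left_comm γ]
  exact mul_lt_mul_of_pos_left (h.div_add_div_lt hγ hμ hω) hμ

theorem asymmetricDet_neg (h : IsAsymmetricSolution γ ω μ t₁ t₂) (hγ : 0 < γ) (hμ : 0 < μ)
    (hω : 0 ≤ ω) : asymmetricDet γ ω μ t₁ t₂ (1 / μ) < 0 :=
  matchDet_neg (h.jostSlope_neg hμ) (h.jostSlope_pos hμ)
    (h.inv_jostSlope_add_inv_jostSlope_lt hγ hμ hω)

theorem existsUnique_asymmetricDet_eq_zero (h : IsAsymmetricSolution γ ω μ t₁ t₂) (hγ : 0 < γ)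
    (hμ : 0 < μ) (hω : 0 < ω) : ∃! m, 1 / μ < m ∧ asymmetricDet γ ω μ t₁ t₂ m = 0 :=
  existsUnique_matchDet_jostSlope_eq_zero (one_div_pos.2 hμ) (Real.artanh_pos (h.mem_Ioo₁ hμ))
    (Real.artanh_pos (h.mem_Ioo₂ hμ)) (h.jostSlope_neg hμ) (h.jostSlope_pos hμ)
    (mul_pos hγ (mul_pos hμ (Real.sqrt_pos.2 hω)))
    (h.inv_jostSlope_add_inv_jostSlope_lt hγ hμ hω.le)

end IsAsymmetricSolution

theorem level_one_div_eq_zero (hω : 0 ≤ ω) (hμ : μ ≠ 0) :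
    ω - (μ * √ω) ^ 2 * (1 / μ) ^ 2 = 0 := by
  rw [mul_pow, Real.sq_sqrt hω]
  field

theorem exists_level_eq (hω : 0 < ω) (hμ : 0 < μ) {ν : ℝ} (hν : ν < 0) :
    ∃ m, 1 / μ < m ∧ ω - (μ * √ω) ^ 2 * m ^ 2 = ν := by
  have hs := Real.sqrt_pos.2 hω
  refine ⟨√(ω - ν) / (μ * √ω), ?_, ?_⟩
  · rw [div_lt_div_iff₀ hμ (mul_pos hμ hs), one_mul, mul_comm]
    exact mul_lt_mul_of_pos_right (Real.sqrt_lt_sqrt hω.le (by linarith)) hμ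
  · rw [div_pow, Real.sq_sqrt (by linarith)]
    field

theorem level_neg (hω : 0 < ω) (hμ : 0 < μ) (hm : 1 / μ < m) :
    ω - (μ * √ω) ^ 2 * m ^ 2 < 0 := by
  rw [← level_one_div_eq_zero hω.le hμ.ne']
  have := Real.sqrt_pos.2 hω
  gcongr

end AsymmetricState

end

theorem proposition6p4 (γ μ lam ω : ℝ) (hγ : 0 < γ) (hμ : 0 < μ) (hlam : 0 < lam)
    (hω : omegaStar γ μ < ω) :
    (∃! t : ℝ × ℝ, IsAsymmetricSolution γ ω μ t.1 t.2) ∧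
    ∀ t₁ t₂ θ : ℝ, IsAsymmetricSolution γ ω μ t₁ t₂ →
      let L₁ := linearizedL1 γ ω μ lam (asymmetricState ω μ lam t₁ t₂ θ)
        (memLp_linearizedPotential hμ ω lam t₁ t₂ θ)
      eigenspaceOf L₁ 0 = ⊥ ∧
      ∃ ν : ℝ, ν < 0 ∧ Module.finrank ℂ (eigenspaceOf L₁ ν) = 1 ∧
        ∀ ν' : ℝ, ν' < 0 → eigenspaceOf L₁ ν' ≠ ⊥ → ν' = ν := by
  have hω₀ : 0 < ω := lt_trans (by unfold omegaStar; positivity) hω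
  refine ⟨existsUnique_isAsymmetricSolution hγ hμ hω, fun t₁ t₂ θ h => ?_⟩
  have ht₁ := h.mem_Ioo₁ hμ
  have ht₂ := h.mem_Ioo₂ hμ
  obtain ⟨m, ⟨hm, hdet⟩, huniq⟩ := h.existsUnique_asymmetricDet_eq_zero hγ hμ hω₀
  refine ⟨?_, ω - (μ * √ω) ^ 2 * m ^ 2, level_neg hω₀ hμ hm,
    finrank_eigenspaceOf_of_asymmetricDet_eq_zero hω₀ hμ hlam ht₁ ht₂ hm.le hdet,
    fun ν hν hne => ?_⟩
  · have hker := eigenspaceOf_eq_bot_of_asymmetricDet_ne_zero (θ := θ) hω₀ hμ hlam ht₁ ht₂ le_rfl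
      (h.asymmetricDet_neg hγ hμ hω₀.le).ne
    rwa [level_one_div_eq_zero hω₀.le hμ.ne', Complex.ofReal_zero] at hker
  · obtain ⟨n, hn, rfl⟩ := exists_level_eq hω₀ hμ hν
    have hdet' : asymmetricDet γ ω μ t₁ t₂ n = 0 := by
      by_contra hdet'
      exact hne (eigenspaceOf_eq_bot_of_asymmetricDet_ne_zero hω₀ hμ hlam ht₁ ht₂ hn.le hdet')
    rw [huniq n ⟨hn, hdet'⟩]
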